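/- **Languages.** Fix a countably infinite set of names. Terms are $s,t::=a\mid s\bullet t$ ($a$ a name) and patterns are $p,q::=x\mid\ulcorner a\urcorner\mid p\bullet q$ (binding name, name-match, compound). For $\alpha\in\{A,S\}$, $\beta\in\{M,P\}$, $\gamma\in\{D,C\}$, $\delta\in\{NO,NM,I\}$, $\epsilon\in\{B,J\}$ the processes of the language $\mathcal L_{\alpha,\beta,\gamma,\delta,\epsilon}$ are $$P,Q::=\mathbf 0\mid\surd\mid P|Q\mid(\nu a)P\mid \mathbf{if}\ s=t\ \mathbf{then}\ P\ \mathbf{else}\ Q\mid{*}P\mid OutProc\mid InProc .$$ Here $OutProc$ is an output $\overline{s}\langle t_1,\dots,t_n\rangle$ if $\alpha=A$ and $\overline{s}\langle t_1,\dots,t_n\rangle.P$ if $\alpha=S$; $InProc$ is $(s_1(\widetilde{p_1})|\cdots|s_k(\widetilde{p_k}))\rhd P$ with $k=1$ if $\epsilon=B$ (binary languages) and with any $k\ge1$ if $\epsilon=J$ (joining languages). The sequences $\widetilde t,\widetilde p$ have length one if $\beta=M$ and arbitrary length if $\beta=P$; the channels $s$ are absent if $\gamma=D$. If $\delta\ne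 I$, then the channels and the data $t_i$ are names, and the patterns are binding names ($\delta=NO$) or binding names and name-matches ($\delta=NM$). The binding names of an input are pairwise distinct; they bind in its continuation. Structural equivalence $\equiv$ is the least equivalence relation that contains $\alpha$-equivalence, is preserved by all operators other than input prefixes, and satisfies: $|$ is commutative and associative with unit $\mathbf 0$; $\mathbf{if}\ s=t\ \mathbf{then}\ P\ \mathbf{else}\ Q$ is equivalent to $P$ if $s=t$ and to $Q$ if $s\neq t$; $(\nu a)\mathbf 0\equiv\mathbf 0$; $(\nu a)(\nu b)P\equiv(\nu b)(\nu a)P$; $P|(\nu a)Q\equiv(\nu a)(P|Q)$ if $a\notin\mathrm{fn}(P)$; ${*}P\equiv P|{*}P$. Reduction $\to$ is the least relation closed under $\equiv$, parallel composition and restriction that contains $$\overline{s_1}\langle\widetilde{t_1}\rangle.P_1|\cdots|\overline{s_k}\langle\widetilde{t_k}\rangle.P_k\,|\,(s_1(\widetilde{p_1})|\cdots|s_k(\widetilde{p_k}))\rhd Q\;\to\;P_1|\cdots|P_k|\sigma Q$$ whenever matching every $\widetilde{t_i}$ with $\widetilde{p_i}$ succeeds and yields altogether the substitution $\sigma$ (a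 pattern $x$ matches any term, $\ulcorner a\urcorner$ matches only the name $a$, compounds match componentwise, sequences must have equal length); the $P_i$ are omitted if $\alpha=A$, the $s_i$ if $\gamma=D$. Let $\Rightarrow$ be the reflexive transitive closure of $\to$; write $P\to^\omega$ if $P$ has an infinite reduction sequence, and $P\Downarrow$ if $P\Rightarrow P'\equiv P''|\surd$ for some $P',P''$. **Encodings.** A reference equivalence of a language is an equivalence relation $\simeq$ on its processes that is reduction-sensitive: if $T\simeq T'$ and $T'$ can reduce, then $T$ can reduce. An encoding of $\mathcal L_1$ into $\mathcal L_2$ is a map $[\![\cdot]\!]$ from the processes of $\mathcal L_1$ to those of $\mathcal L_2$ with a map $\varphi$ from names to $k$-tuples of names for some $k>0$. It is valid with respect to a reference equivalence $\simeq$ of $\mathcal L_2$ if (with equality of processes up to $\alpha$-equivalence): 1. for every $k$-ary operator $\mathrm{op}$ of $\mathcal L_1$ and finite set $N$ of names there is a $k$-ary context $C$ of $\mathcal L_2$ (every hole occurring exactly once) with $[\![\mathrm{op}(S_1,\dots,S_k)]\!]=C[[\![S_1]\!];\dots;[\![S_k]\!]]$ for all $S_1,\dots,S_k$ with $\mathrm{fn}(S_1)\cup\dots\cup\mathrm{fn}(S_k)=N$;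 2. for every $S$ and every finite-domain substitution $\sigma$ of names for names there is such a substitution $\sigma'$ with $\varphi(\sigma(a))=\sigma'(\varphi(a))$ for all names $a$, and $[\![\sigma S]\!]=\sigma'[\![S]\!]$ if $\sigma$ is injective, $[\![\sigma S]\!]\simeq\sigma'[\![S]\!]$ otherwise; 3. if $S\Rightarrow S'$ then $[\![S]\!]\Rightarrow\simeq[\![S']\!]$; and if $[\![S]\!]\Rightarrow T$ then there is $S'$ with $S\Rightarrow S'$ and $T\Rightarrow\simeq[\![S']\!]$; 4. if $[\![S]\!]\to^\omega$ then $S\to^\omega$; 5. $S\Downarrow$ if and only if $[\![S]\!]\Downarrow$. The coordination degree of a language is the supremum in $\mathbb N\cup\{\infty\}$ of all $n$ for which there are processes $S_1,\dots,S_n$ such that $S_1|\cdots|S_n$ can reduce, but cannot reduce any more if any one $S_j$ is replaced by $\mathbf 0$. **Statement.** (i) If $\mathcal L_1$ is a joining language and $\mathcal L_2$ a binary language, with arbitrary and independent other features, then there is no encoding of $\mathcal L_1$ into $\mathcal L_2$ that is valid with respect to any reference equivalence of $\mathcal L_2$. (ii) Every joining language has coordination degree $\infty$, and every binary language has coordination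 degree $2$. (iii) For all $\alpha,\beta,\gamma,\delta$ and every reference equivalence $\simeq$ of $\mathcal L_{\alpha,\beta,\gamma,\delta,J}$ that contains $\equiv$, there is an encoding of $\mathcal L_{\alpha,\beta,\gamma,\delta,B}$ into $\mathcal L_{\alpha,\beta,\gamma,\delta,J}$ that is valid with respect to $\simeq$. Together with (i): of two languages that differ only in coordination, the joining one is strictly more expressive than the binary one. -/

import Mathlib

namespace Calc

/-! ### Languages: five features -/

inductive Synchronism | A | S
inductive Arity | M | P
inductive Medium | D | C
inductive Matching | NO | NM | I
inductive Coordination | B | J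

/-- The 48 languages. -/
structure Lang where
  sync : Synchronism
  arity : Arity
  medium : Medium
  pat : Matching
  coord : Coordination

/-! ### Syntax -/

/-- A countably infinite set of names. -/
abbrev Name : Type := ℕ

/-- Terms `s, t ::= a | s • t`. -/
inductive Term
  | name (a : Name)
  | comp (s t : Term)

def Term.names : Term → Finset Name
  | .name a => {a}
  | .comp s t => s.names ∪ t.names

def Term.IsName (t : Term) : Prop := ∃ a, t = .name a

/-- Patterns `p, q ::= x | ⌜a⌝ | p • q`: binding names, name-matches, compounds. -/
inductive Pat
  | bind (x : Name)
  | mtch (a : Name)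
  | comp (p q : Pat)

/-- The names matched (hence free) in a pattern. -/
def Pat.free : Pat → Finset Name
  | .bind _ => ∅
  | .mtch a => {a}
  | .comp p q => p.free ∪ q.free

/-- The list of binding occurrences in a pattern. -/
def Pat.binders : Pat → List Name
  | .bind x => [x]
  | .mtch _ => []
  | .comp p q => p.binders ++ q.binders

/-- An output `OUT`: the channel (absent in dataspace-based languages) and the data. -/
structure Out where
  ch : Option Term
  data : List Term

/-- One input component `IN`: the channel (absent in dataspace-based languages) and the
patterns. -/
structure Inp where
  ch : Option Term
  pats : List Pat

def chNames : Option Term → Finset Name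
  | none => ∅
  | some s => s.names

def Out.names (o : Out) : Finset Name :=
  chNames o.ch ∪ o.data.foldr (fun t N => t.names ∪ N) ∅

def Inp.free (i : Inp) : Finset Name :=
  chNames i.ch ∪ i.pats.foldr (fun p N => p.free ∪ N) ∅

def Inp.binders (i : Inp) : List Name := i.pats.flatMap Pat.binders

def inpFree (I : List Inp) : Finset Name := I.foldr (fun i N => i.free ∪ N) ∅

def inpBinders (I : List Inp) : List Name := I.flatMap Inp.binders

/-- Processes over the union of all the syntaxes; `Lang.WF` below selects the processes of
each language. `aout o` is the asynchronous output `OUT`, `sout o P` the synchronous output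
`OUT.P`, and `inp [i₁, …, iₖ] P` the join of the inputs `i₁ | … | iₖ` with continuation `P`;
a binary input `IN.P` is `inp [IN] P`. `ok` is the success process. -/
inductive Proc
  | nil
  | ok
  | par (P Q : Proc)
  | res (a : Name) (P : Proc)
  | ite (s t : Term) (P Q : Proc)
  | rep (P : Proc)
  | aout (o : Out)
  | sout (o : Out) (P : Proc)
  | inp (I : List Inp) (P : Proc)

/-- Free names. -/
def Proc.fn : Proc → Finset Name
  | .nil => ∅
  | .ok => ∅
  | .par P Q => P.fn ∪ Q.fn
  | .res a P => P.fn.erase a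
  | .ite s t P Q => s.names ∪ t.names ∪ P.fn ∪ Q.fn
  | .rep P => P.fn
  | .aout o => o.names
  | .sout o P => o.names ∪ P.fn
  | .inp I P => inpFree I ∪ (P.fn \ (inpBinders I).toFinset)

/-! ### Well-formedness in a language -/

/-- Terms in outputs and channels: names only, unless the language is intensional. -/
def Lang.TermOK (L : Lang) (t : Term) : Prop :=
  match L.pat with
  | .I => True
  | _ => t.IsName

def Lang.PatOK (L : Lang) (p : Pat) : Prop :=
  match L.pat with
  | .NO => ∃ x, p = .bind x
  | .NM => (∃ x, p = .bind x) ∨ ∃ a, p = .mtch a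
  | .I => True

def Lang.ChOK (L : Lang) (c : Option Term) : Prop :=
  match L.medium with
  | .D => c = none
  | .C => ∃ s, c = some s ∧ L.TermOK s

def Lang.LenOK (L : Lang) (n : ℕ) : Prop :=
  match L.arity with
  | .M => n = 1
  | .P => True

def Lang.OutOK (L : Lang) (o : Out) : Prop :=
  L.ChOK o.ch ∧ L.LenOK o.data.length ∧ ∀ t ∈ o.data, L.TermOK t

def Lang.InpOK (L : Lang) (i : Inp) : Prop :=
  L.ChOK i.ch ∧ L.LenOK i.pats.length ∧ ∀ p ∈ i.pats, L.PatOK p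

def Lang.JoinOK (L : Lang) (n : ℕ) : Prop :=
  match L.coord with
  | .B => n = 1
  | .J => 1 ≤ n

/-- `L.WF P`: `P` is a (well-formed) process of the language `L`. In every input all binding
names are pairwise distinct. -/
def Lang.WF (L : Lang) : Proc → Prop
  | .nil => True
  | .ok => True
  | .par P Q => L.WF P ∧ L.WF Q
  | .res _ P => L.WF P
  | .ite _ _ P Q => L.WF P ∧ L.WF Q
  | .rep P => L.WF P
  | .aout o => L.sync = .A ∧ L.OutOK o
  | .sout o P => L.sync = .S ∧ L.OutOK o ∧ L.WF P
  | .inp I P => L.JoinOK I.length ∧ (∀ i ∈ I, L.InpOK i) ∧ (inpBinders I).Nodup ∧ L.WF P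

/-- The processes of `L`. -/
def Lang.Processes (L : Lang) : Type := {P : Proc // L.WF P}

/-! ### Substitution -/

def Term.subst (σ : Name → Term) : Term → Term
  | .name a => σ a
  | .comp s t => .comp (s.subst σ) (t.subst σ)

/-- The name-match syntax extended to terms: `⌜s • t⌝ = ⌜s⌝ • ⌜t⌝`. -/
def Term.toPat : Term → Pat
  | .name a => .mtch a
  | .comp s t => .comp s.toPat t.toPat

/-- Apply `ρ` to the binding names and `σ` to the matched names of a pattern. -/
def Pat.subst (ρ : Name → Name) (σ : Name → Term) : Pat → Pat
  | .bind x => .bind (ρ x)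
  | .mtch a => (σ a).toPat
  | .comp p q => .comp (p.subst ρ σ) (q.subst ρ σ)

def Out.subst (σ : Name → Term) (o : Out) : Out :=
  ⟨o.ch.map (Term.subst σ), o.data.map (Term.subst σ)⟩

def Inp.subst (ρ : Name → Name) (σ : Name → Term) (i : Inp) : Inp :=
  ⟨i.ch.map (Term.subst σ), i.pats.map (Pat.subst ρ σ)⟩

/-- A positive number exceeding every element of a finite set of names. -/
def bound (N : Finset Name) : ℕ := N.sup id + 1

/-- Capture-avoiding simultaneous substitution. At each binder the bound names are shifted
beyond all names that could be captured. -/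
def Proc.subst : Proc → (Name → Term) → Proc
  | .nil, _ => .nil
  | .ok, _ => .ok
  | .par P Q, σ => .par (P.subst σ) (Q.subst σ)
  | .res a P, σ =>
      let m := bound ((P.fn.erase a).biUnion fun b => (σ b).names)
      .res (a + m) (P.subst fun b => if b = a then .name (a + m) else σ b)
  | .ite s t P Q, σ => .ite (s.subst σ) (t.subst σ) (P.subst σ) (Q.subst σ)
  | .rep P, σ => .rep (P.subst σ)
  | .aout o, σ => .aout (o.subst σ)
  | .sout o P, σ => .sout (o.subst σ) (P.subst σ)
  | .inp I P, σ =>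
      let m := bound ((P.fn \ (inpBinders I).toFinset).biUnion fun b => (σ b).names)
      .inp (I.map (Inp.subst (fun x => x + m) σ))
        (P.subst fun b => if b ∈ inpBinders I then .name (b + m) else σ b)

/-! ### α-equivalence -/

/-- Literal renaming of all names of a process, bound ones included (used with
transpositions only). -/
def Proc.rename (f : Name → Name) : Proc → Proc
  | .nil => .nil
  | .ok => .ok
  | .par P Q => .par (P.rename f) (Q.rename f)
  | .res a P => .res (f a) (P.rename f)
  | .ite s t P Q =>
      .ite (s.subst fun a => .name (f a)) (t.subst fun a => .name (f a)) (P.rename f) (Q.rename f)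
  | .rep P => .rep (P.rename f)
  | .aout o => .aout (o.subst fun a => .name (f a))
  | .sout o P => .sout (o.subst fun a => .name (f a)) (P.rename f)
  | .inp I P => .inp (I.map (Inp.subst f fun a => .name (f a))) (P.rename f)

/-- α-equivalence: the least congruence that allows a bound name to be replaced by a fresh
one. In `convInp` the free names of the input are left alone. -/
inductive Alpha : Proc → Proc → Prop
  | refl (P) : Alpha P P
  | symm {P Q} : Alpha P Q → Alpha Q P
  | trans {P Q R} : Alpha P Q → Alpha Q R → Alpha P R
  | par {P P' Q Q'} : Alpha P P' → Alpha Q Q' → Alpha (.par P Q) (.par P' Q')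
  | res {P P'} (a) : Alpha P P' → Alpha (.res a P) (.res a P')
  | ite {P P' Q Q'} (s t) : Alpha P P' → Alpha Q Q' → Alpha (.ite s t P Q) (.ite s t P' Q')
  | rep {P P'} : Alpha P P' → Alpha (.rep P) (.rep P')
  | sout {P P'} (o) : Alpha P P' → Alpha (.sout o P) (.sout o P')
  | inp {P P'} (I) : Alpha P P' → Alpha (.inp I P) (.inp I P')
  | convRes (a b : Name) (P : Proc) : b ∉ P.fn →
      Alpha (.res a P) (.res b (P.rename (Equiv.swap a b)))
  | convInp (a b : Name) (I : List Inp) (P : Proc) :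
      a ∈ inpBinders I → b ∉ inpBinders I → b ∉ P.fn →
      Alpha (.inp I P)
        (.inp (I.map (Inp.subst (Equiv.swap a b) Term.name)) (P.rename (Equiv.swap a b)))

/-! ### Structural equivalence -/

/-- The axioms of structural equivalence. -/
inductive SCAxiom : Proc → Proc → Prop
  | parNil (P) : SCAxiom (.par P .nil) P
  | parComm (P Q) : SCAxiom (.par P Q) (.par Q P)
  | parAssoc (P Q R) : SCAxiom (.par P (.par Q R)) (.par (.par P Q) R)
  | iteEq (s t P Q) : s = t → SCAxiom (.ite s t P Q) P
  | iteNe (s t P Q) : s ≠ t → SCAxiom (.ite s t P Q) Q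
  | alpha {P P'} : Alpha P P' → SCAxiom P P'
  | resNil (a) : SCAxiom (.res a .nil) .nil
  | resComm (a b P) : SCAxiom (.res a (.res b P)) (.res b (.res a P))
  | scope (a P Q) : a ∉ P.fn → SCAxiom (.par P (.res a Q)) (.res a (.par P Q))
  | rep (P) : SCAxiom (.rep P) (.par P (.rep P))

/-- Structural equivalence `≡` on the processes of `L`: the least equivalence containing the
axioms and preserved by all operators except input prefixes. (Under an input binding `x` the
test in `if x = a then P else Q` is not yet decided, so the axioms for conditionals must not
be applied there.) -/
inductive SC (L : Lang) : Proc → Proc → Prop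
  | refl {P} : L.WF P → SC L P P
  | symm {P Q} : SC L P Q → SC L Q P
  | trans {P Q R} : SC L P Q → SC L Q R → SC L P R
  | ax {P Q} : L.WF P → L.WF Q → SCAxiom P Q → SC L P Q
  | par {P P' Q Q'} : SC L P P' → SC L Q Q' → SC L (.par P Q) (.par P' Q')
  | res {P P'} (a) : SC L P P' → SC L (.res a P) (.res a P')
  | ite {P P' Q Q'} (s t) : SC L P P' → SC L Q Q' → SC L (.ite s t P Q) (.ite s t P' Q')
  | rep {P P'} : SC L P P' → SC L (.rep P) (.rep P')
  | sout {P P'} (o) : L.sync = .S → L.OutOK o → SC L P P' → SC L (.sout o P) (.sout o P')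

/-! ### Matching and reduction -/

/-- Finite substitutions as association lists; on well-formed inputs the unions taken below
have disjoint domains. -/
abbrev Subst : Type := List (Name × Term)

def Subst.fn (σ : Subst) (a : Name) : Term := (List.lookup a σ).getD (.name a)

/-- `Match t p σ`: matching the term `t` with the pattern `p` is defined and yields `σ`. -/
inductive Match : Term → Pat → Subst → Prop
  | bind (t x) : Match t (.bind x) [(x, t)]
  | mtch (a) : Match (.name a) (.mtch a) []
  | comp {s t p q σ₁ σ₂} : Match s p σ₁ → Match t q σ₂ →
      Match (.comp s t) (.comp p q) (σ₁ ++ σ₂)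

/-- Poly-match of a sequence of terms with a sequence of patterns. -/
inductive PolyMatch : List Term → List Pat → Subst → Prop
  | nil : PolyMatch [] [] []
  | cons {s p ts ps σ₁ σ₂} : Match s p σ₁ → PolyMatch ts ps σ₂ →
      PolyMatch (s :: ts) (p :: ps) (σ₁ ++ σ₂)

/-- Outputs `o₁, …, oₖ` match the inputs `i₁, …, iₖ`, with equal channels, and the union of
the poly-matches is `σ`. -/
inductive JoinMatch : List Out → List Inp → Subst → Prop
  | nil : JoinMatch [] [] []
  | cons {o i os is σ₁ σ₂} : o.ch = i.ch → PolyMatch o.data i.pats σ₁ → JoinMatch os is σ₂ →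
      JoinMatch (o :: os) (i :: is) (σ₁ ++ σ₂)

/-- `parList [P₁, …, Pₖ] Q = P₁ | (P₂ | … (Pₖ | Q))`. -/
def parList (Ps : List Proc) (Q : Proc) : Proc := Ps.foldr .par Q

/-- Reduction in `L`. The two interaction axioms are for asynchronous and synchronous
languages; binary interaction is the case of a single output. -/
inductive Red (L : Lang) : Proc → Proc → Prop
  | commA {os : List Out} {I : List Inp} {σ : Subst} {Q : Proc} :
      L.WF (parList (os.map .aout) (.inp I Q)) → JoinMatch os I σ →
      Red L (parList (os.map .aout) (.inp I Q)) (Q.subst σ.fn)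
  | commS {os : List (Out × Proc)} {I : List Inp} {σ : Subst} {Q : Proc} :
      L.WF (parList (os.map fun o => .sout o.1 o.2) (.inp I Q)) →
      JoinMatch (os.map Prod.fst) I σ →
      Red L (parList (os.map fun o => .sout o.1 o.2) (.inp I Q))
        (parList (os.map Prod.snd) (Q.subst σ.fn))
  | par {P P' Q} : L.WF Q → Red L P P' → Red L (.par P Q) (.par P' Q)
  | res {P P'} (a) : Red L P P' → Red L (.res a P) (.res a P')
  | struct {P Q Q' P'} : SC L P Q → Red L Q Q' → SC L Q' P' → Red L P P'

namespace Lang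

variable {L : Lang}

def StructEquiv (P Q : L.Processes) : Prop := SC L P.1 Q.1

def Step (P Q : L.Processes) : Prop := Red L P.1 Q.1

def Steps : L.Processes → L.Processes → Prop := Relation.ReflTransGen Step

def Reduces (P : L.Processes) : Prop := ∃ Q, Step P Q

def Diverges (P : L.Processes) : Prop :=
  ∃ f : ℕ → L.Processes, f 0 = P ∧ ∀ n, Step (f n) (f (n + 1))

/-- `P` can reach a process with a top-level success process. -/
def Succeeds (P : L.Processes) : Prop :=
  ∃ (P' : L.Processes) (P'' : Proc), Steps P P' ∧ SC L P'.1 (.par P'' .ok)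

end Lang

/-- The requirements on a reference behavioural equivalence: it is an equivalence relation
and it is reduction-sensitive. -/
structure IsReference (L : Lang) (R : L.Processes → L.Processes → Prop) : Prop where
  equivalence : Equivalence R
  reduction_sensitive : ∀ T T', R T T' → Lang.Reduces T' → Lang.Reduces T

/-! ### Coordination degree -/

def Lang.nilP (L : Lang) : L.Processes := ⟨.nil, trivial⟩

/-- `P₁ | (P₂ | … (Pₖ | 0))`. -/
def Lang.parAll (L : Lang) (Ps : List L.Processes) : L.Processes :=
  Ps.foldr (fun P Q => ⟨.par P.1 Q.1, P.2, Q.2⟩) L.nilP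

/-- The processes `S₁, …, Sₙ` must all coordinate to yield a reduction: their parallel
composition reduces, but not if any one of them is replaced by the null process. -/
def Lang.MustCoordinate (L : Lang) {n : ℕ} (S : Fin n → L.Processes) : Prop :=
  Lang.Reduces (L.parAll (List.ofFn S)) ∧
    ∀ j, ¬ Lang.Reduces (L.parAll (List.ofFn (Function.update S j L.nilP)))

/-- The least upper bound on the number of processes that must coordinate to yield a
reduction. -/
noncomputable def Lang.coordDegree (L : Lang) : ℕ∞ :=
  sSup {d | ∃ (n : ℕ) (S : Fin n → L.Processes), d = n ∧ L.MustCoordinate S}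

/-! ### Operators and contexts -/

/-- The operators of the process syntax. -/
inductive Op
  | nil
  | ok
  | par
  | res (a : Name)
  | ite (s t : Term)
  | rep
  | aout (o : Out)
  | sout (o : Out)
  | inp (I : List Inp)

def Op.arity : Op → ℕ
  | .nil => 0
  | .ok => 0
  | .par => 2
  | .res _ => 1
  | .ite _ _ => 2
  | .rep => 1
  | .aout _ => 0
  | .sout _ => 1
  | .inp _ => 1

def Op.app : (op : Op) → (Fin op.arity → Proc) → Proc
  | .nil, _ => .nil
  | .ok, _ => .ok
  | .par, S => .par (S (0 : Fin 2)) (S (1 : Fin 2))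
  | .res a, S => .res a (S (0 : Fin 1))
  | .ite s t, S => .ite s t (S (0 : Fin 2)) (S (1 : Fin 2))
  | .rep, S => .rep (S (0 : Fin 1))
  | .aout o, _ => .aout o
  | .sout o, S => .sout o (S (0 : Fin 1))
  | .inp I, S => .inp I (S (0 : Fin 1))

/-- `op` is an operator of the language `L`. -/
def Lang.OpOK (L : Lang) (op : Op) : Prop := L.WF (op.app fun _ => .nil)

theorem Lang.OpOK.wf {L : Lang} {op : Op} (h : L.OpOK op) (S : Fin op.arity → L.Processes) :
    L.WF (op.app fun i => (S i).1) := by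
  cases op with
  | nil => exact h
  | ok => exact h
  | par => exact ⟨(S (0 : Fin 2)).2, (S (1 : Fin 2)).2⟩
  | res a => exact (S (0 : Fin 1)).2
  | ite s t => exact ⟨(S (0 : Fin 2)).2, (S (1 : Fin 2)).2⟩
  | rep => exact (S (0 : Fin 1)).2
  | aout o => exact h
  | sout o => exact ⟨h.1, h.2.1, (S (0 : Fin 1)).2⟩
  | inp I => exact ⟨h.1, h.2.1, h.2.2.1, (S (0 : Fin 1)).2⟩

/-- Processes with holes numbered by `Fin k`. -/
inductive Ctx (k : ℕ)
  | hole (i : Fin k)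
  | nil
  | ok
  | par (C D : Ctx k)
  | res (a : Name) (C : Ctx k)
  | ite (s t : Term) (C D : Ctx k)
  | rep (C : Ctx k)
  | aout (o : Out)
  | sout (o : Out) (C : Ctx k)
  | inp (I : List Inp) (C : Ctx k)

/-- Literal (possibly capturing) filling of the holes. -/
def Ctx.fill {k : ℕ} (T : Fin k → Proc) : Ctx k → Proc
  | .hole i => T i
  | .nil => .nil
  | .ok => .ok
  | .par C D => .par (C.fill T) (D.fill T)
  | .res a C => .res a (C.fill T)
  | .ite s t C D => .ite s t (C.fill T) (D.fill T)
  | .rep C => .rep (C.fill T)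
  | .aout o => .aout o
  | .sout o C => .sout o (C.fill T)
  | .inp I C => .inp I (C.fill T)

/-- The list of occurrences of holes. -/
def Ctx.holes {k : ℕ} : Ctx k → List (Fin k)
  | .hole i => [i]
  | .nil => []
  | .ok => []
  | .par C D => C.holes ++ D.holes
  | .res _ C => C.holes
  | .ite _ _ C D => C.holes ++ D.holes
  | .rep C => C.holes
  | .aout _ => []
  | .sout _ C => C.holes
  | .inp _ C => C.holes

/-- `C` is a `k`-ary context of `L`: a process of `L` in which `k` occurrences of `0` are
replaced by holes, every hole occurring exactly once. -/
def Lang.IsContext (L : Lang) {k : ℕ} (C : Ctx k) : Prop :=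
  (∀ i, C.holes.count i = 1) ∧ L.WF (C.fill fun _ => .nil)

/-! ### Substitution of names for names -/

theorem Lang.TermOK.subst_name {L : Lang} {t : Term} (f : Name → Name) (h : L.TermOK t) :
    L.TermOK (t.subst fun a => .name (f a)) := by
  unfold Lang.TermOK at *
  split at h
  · trivial
  · obtain ⟨a, rfl⟩ := h
    exact ⟨f a, rfl⟩

theorem Lang.ChOK.subst_name {L : Lang} {c : Option Term} (f : Name → Name) (h : L.ChOK c) :
    L.ChOK (c.map (Term.subst fun a => .name (f a))) := by
  unfold Lang.ChOK at *
  split at h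
  · simp [h]
  · obtain ⟨s, rfl, hs⟩ := h
    exact ⟨_, rfl, hs.subst_name f⟩

theorem Lang.OutOK.subst_name {L : Lang} {o : Out} (f : Name → Name) (h : L.OutOK o) :
    L.OutOK (o.subst fun a => .name (f a)) := by
  refine ⟨h.1.subst_name f, by simpa [Out.subst] using h.2.1, ?_⟩
  intro t ht
  obtain ⟨s, hs, rfl⟩ := List.mem_map.1 ht
  exact (h.2.2 s hs).subst_name f

theorem Lang.PatOK.subst_name {L : Lang} {p : Pat} (ρ f : Name → Name) (h : L.PatOK p) :
    L.PatOK (p.subst ρ fun a => .name (f a)) := by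
  unfold Lang.PatOK at *
  split at h
  · obtain ⟨x, rfl⟩ := h
    exact ⟨_, rfl⟩
  · rcases h with ⟨x, rfl⟩ | ⟨x, rfl⟩
    · exact Or.inl ⟨_, rfl⟩
    · exact Or.inr ⟨_, rfl⟩
  · trivial

theorem Lang.InpOK.subst_name {L : Lang} {i : Inp} (ρ f : Name → Name) (h : L.InpOK i) :
    L.InpOK (i.subst ρ fun a => .name (f a)) := by
  refine ⟨h.1.subst_name f, by simpa [Inp.subst] using h.2.1, ?_⟩
  intro t ht
  obtain ⟨s, hs, rfl⟩ := List.mem_map.1 ht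
  exact (h.2.2 s hs).subst_name ρ f

theorem Term.toPat_binders (t : Term) : t.toPat.binders = [] := by
  induction t with
  | name a => rfl
  | comp s t hs ht => simp [Term.toPat, Pat.binders, hs, ht]

theorem Pat.binders_subst (ρ : Name → Name) (σ : Name → Term) (p : Pat) :
    (p.subst ρ σ).binders = p.binders.map ρ := by
  induction p with
  | bind x => rfl
  | mtch a => exact Term.toPat_binders _
  | comp p q hp hq => simp [Pat.subst, Pat.binders, hp, hq]

theorem inpBinders_subst (ρ : Name → Name) (σ : Name → Term) (I : List Inp) :
    inpBinders (I.map (Inp.subst ρ σ)) = (inpBinders I).map ρ := by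
  simp [inpBinders, Inp.binders, Inp.subst, List.flatMap_map, List.map_flatMap,
    Pat.binders_subst]

theorem Lang.WF.subst_name {L : Lang} {P : Proc} (h : L.WF P) (f : Name → Name) :
    L.WF (P.subst fun a => .name (f a)) := by
  induction P generalizing f with
  | nil => trivial
  | ok => trivial
  | par P Q hP hQ => exact ⟨hP h.1 f, hQ h.2 f⟩
  | res a P hP =>
    have key : ∀ m : ℕ, (fun b => if b = a then Term.name (a + m) else .name (f b)) =
        fun b => Term.name (if b = a then a + m else f b) := by
      intro m; funext b; split <;> rfl
    simp only [Proc.subst, key]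
    exact hP h _
  | ite s t P Q hP hQ => exact ⟨hP h.1 f, hQ h.2 f⟩
  | rep P hP => exact hP h f
  | aout o => exact ⟨h.1, h.2.subst_name f⟩
  | sout o P hP => exact ⟨h.1, h.2.1.subst_name f, hP h.2.2 f⟩
  | inp I P hP =>
    have key : ∀ m : ℕ,
        (fun b => if b ∈ inpBinders I then Term.name (b + m) else .name (f b)) =
        fun b => Term.name (if b ∈ inpBinders I then b + m else f b) := by
      intro m; funext b; split <;> rfl
    simp only [Proc.subst, key]
    refine ⟨by simpa using h.1, ?_, ?_, hP h.2.2.2 _⟩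
    · intro i hi
      obtain ⟨j, hj, rfl⟩ := List.mem_map.1 hi
      exact (h.2.1 j hj).subst_name _ f
    · rw [inpBinders_subst]
      exact h.2.2.1.map fun x y hxy => Nat.add_right_cancel hxy

/-- Application of a substitution of names for names. -/
def Lang.substNames {L : Lang} (f : Name → Name) (P : L.Processes) : L.Processes :=
  ⟨P.1.subst fun a => .name (f a), P.2.subst_name f⟩

/-- A substitution of names for names has finite domain. -/
def IsNameSubst (f : Name → Name) : Prop := {a | f a ≠ a}.Finite

/-! ### Valid encodings -/

/-- An encoding: a translation of processes and a renaming policy that maps every name to a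
tuple of `k > 0` names. -/
structure Encoding (L₁ L₂ : Lang) where
  tr : L₁.Processes → L₂.Processes
  k : ℕ
  k_pos : 0 < k
  ren : Name → Fin k → Name

namespace Encoding

variable {L₁ L₂ : Lang}

/-- Processes are compared up to α-equivalence. -/
def Compositional (e : Encoding L₁ L₂) : Prop :=
  ∀ (op : Op) (hop : L₁.OpOK op) (N : Finset Name), ∃ C : Ctx op.arity, L₂.IsContext C ∧
    ∀ S : Fin op.arity → L₁.Processes,
      (Finset.univ.biUnion fun i => (S i).1.fn) = N →
      Alpha (e.tr ⟨op.app fun i => (S i).1, hop.wf S⟩).1 (C.fill fun i => (e.tr (S i)).1)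

/-- Processes are compared up to α-equivalence. -/
def NameInvariant (e : Encoding L₁ L₂) (R : L₂.Processes → L₂.Processes → Prop) : Prop :=
  ∀ (S : L₁.Processes) (f : Name → Name), IsNameSubst f →
    ∃ g : Name → Name, IsNameSubst g ∧ (∀ a i, e.ren (f a) i = g (e.ren a i)) ∧
      (Function.Injective f →
        Alpha (e.tr (Lang.substNames f S)).1 (Lang.substNames g (e.tr S)).1) ∧
      (¬ Function.Injective f → R (e.tr (Lang.substNames f S)) (Lang.substNames g (e.tr S)))

def OperationallyCorresponding (e : Encoding L₁ L₂) (R : L₂.Processes → L₂.Processes → Prop) :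
    Prop :=
  (∀ S S' : L₁.Processes, Lang.Steps S S' → ∃ T, Lang.Steps (e.tr S) T ∧ R T (e.tr S')) ∧
  (∀ (S : L₁.Processes) (T : L₂.Processes), Lang.Steps (e.tr S) T →
    ∃ (S' : L₁.Processes) (T' : L₂.Processes), Lang.Steps S S' ∧ Lang.Steps T T' ∧ R T' (e.tr S'))

/-- Valid encodings, with respect to the reference equivalence `R` of the target. -/
structure Valid (e : Encoding L₁ L₂) (R : L₂.Processes → L₂.Processes → Prop) : Prop where
  compositional : e.Compositional
  name_invariant : e.NameInvariant R
  operational : e.OperationallyCorresponding R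
  divergence : ∀ S, Lang.Diverges (e.tr S) → Lang.Diverges S
  success : ∀ S, Lang.Succeeds S ↔ Lang.Succeeds (e.tr S)

end Encoding

end Calc

namespace Calc

/-! ### Renaming -/

/-! A binary interaction involves two prefixes, hence at most two components of a composite process,
whereas a join of `k` inputs needs `k` outputs at once and so `k + 1` components.

To make the first half precise, a process is abstracted to its set of capabilities `Proc.acts`, in
which restricted names become anonymous, and to the predicate `Proc.CanReact`, which says that two
active prefixes match. Both are invariant under structural equivalence (`SC.acts_eq`). In a binary
language `CanReact` holds exactly if the process reduces: one direction is an induction on the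
reduction, the other exposes the two prefixes by scope extrusion (`Lang.exposes_of_mem_acts`,
`Red.of_cross`). By `IsBinary.fill`, an interaction in a filled context depends on at most two of
the fillings, and a capability on at most one. For the second half it is enough to count: a
reduction needs at least as many active outputs as the smallest active join has inputs
(`Red.minJoin_le_nOut`). The two facts together give the coordination degrees.

For the separation, let `J` join two inputs and consider `O | (O | J)`, which reduces to success.
All three components, and an inert process `Z`, have the same free names, so by compositionality a
single context `C` translates every parallel composition involved, and the translation is `C[O; C[O;
J]]`. It must reach success. Either success is already active, and is then due to one component, or
the translation reduces, and that is due to two. In both cases some other component can be replaced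
by `Z` without destroying this. The corresponding source is stuck and has no success, so the first
case violates success sensitivity. The second contradicts `Encoding.Valid.not_reduces`: a reducing
translation of a stuck process would diverge, since every derivative can evolve to something
equivalent to the translation, which by reduction sensitivity reduces again.

Conversely, inclusion encodes a binary language into the joining one. The only difficulty is that
structural equivalence of the larger language can introduce proper joins in discarded branches of
conditionals. `Proc.LiveBinary` tolerates precisely these and is preserved by reduction, while
`Proc.binarize` deletes them and maps equivalences and reductions back to the binary language. -/

theorem Term.subst_subst (σ τ : Name → Term) (t : Term) :
    (t.subst σ).subst τ = t.subst fun a => (σ a).subst τ := by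
  induction t with
  | name a => rfl
  | comp s t hs ht => simp [Term.subst, hs, ht]

theorem Term.subst_congr {σ τ : Name → Term} {t : Term} (h : ∀ a ∈ t.names, σ a = τ a) :
    t.subst σ = t.subst τ := by
  induction t with
  | name a => exact h a (by simp [Term.names])
  | comp s t hs ht =>
    simp only [Term.names, Finset.mem_union] at h
    simp [Term.subst, hs fun a ha => h a (.inl ha), ht fun a ha => h a (.inr ha)]

theorem Term.subst_name_injective {f : Name → Name} (hf : Function.Injective f) :
    Function.Injective fun t : Term => t.subst fun a => .name (f a) := by
  intro s
  induction s with
  | name a =>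
    intro t h
    cases t with
    | name b => simpa [Term.subst, hf.eq_iff] using h
    | comp t₁ t₂ => simp [Term.subst] at h
  | comp s₁ s₂ h₁ h₂ =>
    intro t h
    cases t with
    | name b => simp [Term.subst] at h
    | comp t₁ t₂ =>
      simp only [Term.subst, Term.comp.injEq] at h
      rw [h₁ h.1, h₂ h.2]

theorem Term.subst_name_eq_iff {f : Name → Name} (hf : Function.Injective f) (s t : Term) :
    (s.subst fun a => .name (f a)) = (t.subst fun a => .name (f a)) ↔ s = t :=
  (Term.subst_name_injective hf).eq_iff

theorem Lang.WF.rename {L : Lang} {P : Proc} (h : L.WF P) {f : Name → Name}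
    (hf : Function.Injective f) : L.WF (P.rename f) := by
  induction P with
  | nil => trivial
  | ok => trivial
  | par P Q hP hQ => exact ⟨hP h.1, hQ h.2⟩
  | res a P hP => exact hP h
  | ite s t P Q hP hQ => exact ⟨hP h.1, hQ h.2⟩
  | rep P hP => exact hP h
  | aout o => exact ⟨h.1, h.2.subst_name f⟩
  | sout o P hP => exact ⟨h.1, h.2.1.subst_name f, hP h.2.2⟩
  | inp I P hP =>
    refine ⟨by simpa using h.1, ?_, ?_, hP h.2.2.2⟩
    · intro i hi
      obtain ⟨j, hj, rfl⟩ := List.mem_map.1 hi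
      exact (h.2.1 j hj).subst_name _ f
    · rw [inpBinders_subst]
      exact h.2.2.1.map hf

/-! ### Structural equivalence -/

theorem SC.wf {L : Lang} {P Q : Proc} (h : SC L P Q) : L.WF P ∧ L.WF Q := by
  induction h with
  | refl h => exact ⟨h, h⟩
  | symm _ ih => exact ⟨ih.2, ih.1⟩
  | trans _ _ ih₁ ih₂ => exact ⟨ih₁.1, ih₂.2⟩
  | ax h₁ h₂ _ => exact ⟨h₁, h₂⟩
  | par _ _ ih₁ ih₂ => exact ⟨⟨ih₁.1, ih₂.1⟩, ⟨ih₁.2, ih₂.2⟩⟩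
  | res a _ ih => exact ih
  | ite s t _ _ ih₁ ih₂ => exact ⟨⟨ih₁.1, ih₂.1⟩, ⟨ih₁.2, ih₂.2⟩⟩
  | rep _ ih => exact ih
  | sout o hs ho _ ih => exact ⟨⟨hs, ho, ih.1⟩, ⟨hs, ho, ih.2⟩⟩

theorem SC.parComm {L : Lang} {P Q : Proc} (hP : L.WF P) (hQ : L.WF Q) :
    SC L (.par P Q) (.par Q P) := .ax ⟨hP, hQ⟩ ⟨hQ, hP⟩ (.parComm P Q)

theorem SC.parAssoc {L : Lang} {P Q R : Proc} (hP : L.WF P) (hQ : L.WF Q) (hR : L.WF R) :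
    SC L (.par P (.par Q R)) (.par (.par P Q) R) :=
  .ax ⟨hP, hQ, hR⟩ ⟨⟨hP, hQ⟩, hR⟩ (.parAssoc P Q R)

theorem SC.parNil {L : Lang} {P : Proc} (hP : L.WF P) : SC L (.par P .nil) P :=
  .ax ⟨hP, trivial⟩ hP (.parNil P)

theorem SC.parLeftComm {L : Lang} {P Q R : Proc} (hP : L.WF P) (hQ : L.WF Q) (hR : L.WF R) :
    SC L (.par P (.par Q R)) (.par Q (.par P R)) :=
  (SC.parAssoc hP hQ hR).trans
    (((SC.parComm hP hQ).par (.refl hR)).trans (SC.parAssoc hQ hP hR).symm)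

theorem SC.parParComm {L : Lang} {P Q R S : Proc} (hP : L.WF P) (hQ : L.WF Q) (hR : L.WF R)
    (hS : L.WF S) : SC L (.par (.par P Q) (.par R S)) (.par (.par P R) (.par Q S)) :=
  (SC.parAssoc hP hQ (show L.WF (.par R S) from ⟨hR, hS⟩)).symm.trans
    (((SC.refl hP).par (SC.parLeftComm hQ hR hS)).trans
      (SC.parAssoc hP hR (show L.WF (.par Q S) from ⟨hQ, hS⟩)))

theorem SC.iteEq {L : Lang} {s t : Term} {P Q : Proc} (h : s = t) (hP : L.WF P) (hQ : L.WF Q) :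
    SC L (.ite s t P Q) P := .ax ⟨hP, hQ⟩ hP (.iteEq s t P Q h)

theorem SC.iteNe {L : Lang} {s t : Term} {P Q : Proc} (h : s ≠ t) (hP : L.WF P) (hQ : L.WF Q) :
    SC L (.ite s t P Q) Q := .ax ⟨hP, hQ⟩ hQ (.iteNe s t P Q h)

theorem SC.repUnfold {L : Lang} {P : Proc} (hP : L.WF P) : SC L (.rep P) (.par P (.rep P)) :=
  .ax hP ⟨hP, hP⟩ (.rep P)

/-- Restriction of a list of names. -/
def resList (A : List Name) (P : Proc) : Proc := A.foldr .res P

theorem resList_wf {L : Lang} {A : List Name} {P : Proc} : L.WF (resList A P) ↔ L.WF P := by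
  induction A with
  | nil => rfl
  | cons a A ih => exact ih

theorem SC.resList {L : Lang} {P Q : Proc} (A : List Name) (h : SC L P Q) :
    SC L (resList A P) (resList A Q) := by
  induction A with
  | nil => exact h
  | cons a A ih => exact ih.res a

theorem Red.resList {L : Lang} {P Q : Proc} (A : List Name) (h : Red L P Q) :
    Red L (resList A P) (resList A Q) := by
  induction A with
  | nil => exact h
  | cons a A ih => exact ih.res a

theorem SC.extrude {L : Lang} {P Q : Proc} {A : List Name} (hP : L.WF P) (hQ : L.WF Q)
    (hA : ∀ a ∈ A, a ∉ P.fn) :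
    SC L (.par P (Calc.resList A Q)) (Calc.resList A (.par P Q)) := by
  induction A with
  | nil => exact .refl (show L.WF (.par P Q) from ⟨hP, hQ⟩)
  | cons a A ih =>
    have hA' : L.WF (Calc.resList A Q) := resList_wf.2 hQ
    exact (SC.ax (show L.WF (.par P (.res a (Calc.resList A Q))) from ⟨hP, hA'⟩)
      (show L.WF (.res a (.par P (Calc.resList A Q))) from ⟨hP, hA'⟩)
      (.scope a P _ (hA a (by simp)))).trans
      ((ih fun b hb => hA b (by simp [hb])).res a)

theorem resList_rename (f : Name → Name) (A : List Name) (P : Proc) :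
    (resList A P).rename f = resList (A.map f) (P.rename f) := by
  induction A with
  | nil => rfl
  | cons a A ih => simpa [resList, Proc.rename] using ih

theorem parList_wf {L : Lang} {Ps : List Proc} {Q : Proc} :
    L.WF (parList Ps Q) ↔ (∀ P ∈ Ps, L.WF P) ∧ L.WF Q := by
  induction Ps with
  | nil => simp [parList]
  | cons P Ps ih =>
    change L.WF P ∧ L.WF (parList Ps Q) ↔ _
    rw [ih]; simp [and_assoc]

theorem SC.parList {L : Lang} {Ps : List Proc} {Q Q' : Proc} (hPs : ∀ P ∈ Ps, L.WF P)
    (h : SC L Q Q') : SC L (parList Ps Q) (parList Ps Q') := by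
  induction Ps with
  | nil => exact h
  | cons P Ps ih =>
    exact (SC.refl (hPs P (by simp))).par (ih fun P hP => hPs P (by simp [hP]))

/-- Brings a process standing before a row of processes to its end, where the interaction axioms
expect the join. -/
theorem SC.par_parList {L : Lang} {Ps : List Proc} {P Q : Proc} (hPs : ∀ P ∈ Ps, L.WF P)
    (hP : L.WF P) (hQ : L.WF Q) :
    SC L (.par P (Calc.parList Ps Q)) (Calc.parList Ps (.par P Q)) := by
  induction Ps with
  | nil => exact .refl (show L.WF (.par P Q) from ⟨hP, hQ⟩)
  | cons P' Ps ih =>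
    have h' : ∀ P ∈ Ps, L.WF P := fun P hP => hPs P (by simp [hP])
    have h₀ : L.WF P' := hPs P' (by simp)
    exact (SC.parLeftComm hP h₀ (parList_wf.2 ⟨h', hQ⟩)).trans ((SC.refl h₀).par (ih h'))

/-! ### Well-formedness of reducts -/

theorem Lang.TermOK.subst {L : Lang} {t : Term} {σ : Name → Term} (hσ : ∀ a, L.TermOK (σ a))
    (h : L.TermOK t) : L.TermOK (t.subst σ) := by
  cases t with
  | name a => exact hσ a
  | comp s t =>
    unfold Lang.TermOK at *
    split at h
    · trivial
    · obtain ⟨a, ha⟩ := h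
      cases ha

theorem Lang.ChOK.subst {L : Lang} {c : Option Term} {σ : Name → Term}
    (hσ : ∀ a, L.TermOK (σ a)) (h : L.ChOK c) : L.ChOK (c.map (Term.subst σ)) := by
  unfold Lang.ChOK at *
  split at h
  · simp [h]
  · obtain ⟨s, rfl, hs⟩ := h
    exact ⟨_, rfl, hs.subst hσ⟩

theorem Lang.OutOK.subst {L : Lang} {o : Out} {σ : Name → Term} (hσ : ∀ a, L.TermOK (σ a))
    (h : L.OutOK o) : L.OutOK (o.subst σ) := by
  refine ⟨h.1.subst hσ, by simpa [Out.subst] using h.2.1, ?_⟩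
  intro t ht
  obtain ⟨s, hs, rfl⟩ := List.mem_map.1 ht
  exact (h.2.2 s hs).subst hσ

theorem Lang.PatOK.subst {L : Lang} {p : Pat} {σ : Name → Term} (ρ : Name → Name)
    (hσ : ∀ a, L.TermOK (σ a)) (h : L.PatOK p) : L.PatOK (p.subst ρ σ) := by
  unfold Lang.PatOK at *
  split at h
  · obtain ⟨x, rfl⟩ := h
    exact ⟨_, rfl⟩
  · rename_i hL
    rcases h with ⟨x, rfl⟩ | ⟨x, rfl⟩
    · exact Or.inl ⟨_, rfl⟩
    · have := hσ x
      simp only [Lang.TermOK, hL] at this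
      obtain ⟨a, ha⟩ := this
      exact Or.inr ⟨a, by simp [Pat.subst, ha, Term.toPat]⟩
  · trivial

theorem Lang.InpOK.subst {L : Lang} {i : Inp} {σ : Name → Term} (ρ : Name → Name)
    (hσ : ∀ a, L.TermOK (σ a)) (h : L.InpOK i) : L.InpOK (i.subst ρ σ) := by
  refine ⟨h.1.subst hσ, by simpa [Inp.subst] using h.2.1, ?_⟩
  intro t ht
  obtain ⟨s, hs, rfl⟩ := List.mem_map.1 ht
  exact (h.2.2 s hs).subst ρ hσ

theorem Lang.termOK_name (L : Lang) (a : Name) : L.TermOK (.name a) := by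
  unfold Lang.TermOK
  split
  · trivial
  · exact ⟨a, rfl⟩

theorem Lang.WF.subst {L : Lang} {P : Proc} (h : L.WF P) {σ : Name → Term}
    (hσ : ∀ a, L.TermOK (σ a)) : L.WF (P.subst σ) := by
  induction P generalizing σ with
  | nil => trivial
  | ok => trivial
  | par P Q hP hQ => exact ⟨hP h.1 hσ, hQ h.2 hσ⟩
  | res a P hP =>
    refine hP h fun b => ?_
    split
    · exact L.termOK_name _
    · exact hσ b
  | ite s t P Q hP hQ => exact ⟨hP h.1 hσ, hQ h.2 hσ⟩
  | rep P hP => exact hP h hσ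
  | aout o => exact ⟨h.1, h.2.subst hσ⟩
  | sout o P hP => exact ⟨h.1, h.2.1.subst hσ, hP h.2.2 hσ⟩
  | inp I P hP =>
    refine ⟨by simpa using h.1, ?_, ?_, hP h.2.2.2 fun b => ?_⟩
    · intro i hi
      obtain ⟨j, hj, rfl⟩ := List.mem_map.1 hi
      exact (h.2.1 j hj).subst _ hσ
    · rw [inpBinders_subst]
      exact h.2.2.1.map fun x y hxy => Nat.add_right_cancel hxy
    · split
      · exact L.termOK_name _
      · exact hσ b

theorem Match.termOK {L : Lang} {t : Term} {p : Pat} {σ : Subst} (h : Match t p σ)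
    (ht : L.TermOK t) : ∀ x ∈ σ, L.TermOK x.2 := by
  induction h with
  | bind t x => simpa using ht
  | mtch a => simp
  | comp _ _ ih₁ ih₂ =>
    -- An admissible compound term exists only in an intensional language, where every term is
    -- admissible.
    have hI : ∀ u, L.TermOK u := by
      intro u
      unfold Lang.TermOK at *
      split at ht
      · trivial
      · obtain ⟨a, ha⟩ := ht
        cases ha
    intro x hx
    exact hI _

theorem PolyMatch.termOK {L : Lang} {ts : List Term} {ps : List Pat} {σ : Subst}
    (h : PolyMatch ts ps σ) (ht : ∀ t ∈ ts, L.TermOK t) : ∀ x ∈ σ, L.TermOK x.2 := by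
  induction h with
  | nil => simp
  | cons h₁ _ ih =>
    intro x hx
    rcases List.mem_append.1 hx with hx | hx
    · exact h₁.termOK (ht _ (by simp)) x hx
    · exact ih (fun t h => ht t (by simp [h])) x hx

theorem JoinMatch.termOK {L : Lang} {os : List Out} {I : List Inp} {σ : Subst}
    (h : JoinMatch os I σ) (ho : ∀ o ∈ os, L.OutOK o) : ∀ x ∈ σ, L.TermOK x.2 := by
  induction h with
  | nil => simp
  | cons _ h₁ _ ih =>
    intro x hx
    rcases List.mem_append.1 hx with hx | hx
    · exact h₁.termOK (ho _ (by simp)).2.2 x hx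
    · exact ih (fun t h => ho t (by simp [h])) x hx

theorem JoinMatch.length_eq {os : List Out} {I : List Inp} {σ : Subst}
    (h : JoinMatch os I σ) : os.length = I.length := by
  induction h with
  | nil => rfl
  | cons _ _ _ ih => simp [ih]

theorem Subst.termOK_fn {L : Lang} {σ : Subst} (h : ∀ x ∈ σ, L.TermOK x.2) (a : Name) :
    L.TermOK (σ.fn a) := by
  induction σ with
  | nil => exact L.termOK_name a
  | cons x σ ih =>
    obtain ⟨y, t⟩ := x
    simp only [Subst.fn, List.lookup_cons]
    by_cases hay : a = y
    · simpa [hay] using h (y, t) (by simp)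
    · have : (a == y) = false := by simpa using hay
      simp only [this]
      exact ih fun x hx => h x (by simp [hx])

theorem Red.wf {L : Lang} {P Q : Proc} (h : Red L P Q) : L.WF P ∧ L.WF Q := by
  induction h with
  | commA h hm =>
    refine ⟨h, ?_⟩
    obtain ⟨ho, hI⟩ := parList_wf.1 h
    exact hI.2.2.2.subst (Subst.termOK_fn (hm.termOK fun o h => (ho _ (List.mem_map_of_mem h)).2))
  | @commS os I σ Q h hm =>
    refine ⟨h, ?_⟩
    obtain ⟨ho, hI⟩ := parList_wf.1 h
    have ho' : ∀ o ∈ os, L.WF (.sout o.1 o.2) := fun o h =>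
      ho _ (List.mem_map.2 ⟨o, h, rfl⟩)
    refine parList_wf.2 ⟨?_, hI.2.2.2.subst (Subst.termOK_fn (hm.termOK ?_))⟩
    · intro P hP
      obtain ⟨o, h, rfl⟩ := List.mem_map.1 hP
      exact (ho' o h).2.2
    · intro P hP
      obtain ⟨o, h, rfl⟩ := List.mem_map.1 hP
      exact (ho' o h).2.1
  | par hQ _ ih => exact ⟨⟨ih.1, hQ⟩, ⟨ih.2, hQ⟩⟩
  | res a _ ih => exact ih
  | struct h₁ _ h₂ _ => exact ⟨h₁.wf.1, h₂.wf.2⟩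

/-- Reducts of well-formed processes are well-formed, so reducibility can be studied on raw
processes. -/
theorem Lang.reduces_iff {L : Lang} (P : L.Processes) : Lang.Reduces P ↔ ∃ Q, Red L P.1 Q :=
  ⟨fun ⟨Q, h⟩ => ⟨Q.1, h⟩, fun ⟨Q, h⟩ => ⟨⟨Q, h.wf.2⟩, h⟩⟩

/-! ### Counting active outputs and the inputs of active joins -/

/-- The number of active outputs. -/
noncomputable def Proc.nOut : Proc → ℕ∞
  | .par P Q => P.nOut + Q.nOut
  | .res _ P => P.nOut
  | .ite s t P Q => open Classical in if s = t then P.nOut else Q.nOut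
  | .rep P => ⊤ * P.nOut
  | .aout _ => 1
  | .sout _ _ => 1
  | _ => 0

/-- The least number of inputs of an active join. -/
noncomputable def Proc.minJoin : Proc → ℕ∞
  | .par P Q => P.minJoin ⊓ Q.minJoin
  | .res _ P => P.minJoin
  | .ite s t P Q => open Classical in if s = t then P.minJoin else Q.minJoin
  | .rep P => P.minJoin
  | .inp I _ => I.length
  -- The infimum over no joins at all.
  | _ => ⊤

theorem Proc.nOut_rename {f : Name → Name} (hf : Function.Injective f) (P : Proc) :
    (P.rename f).nOut = P.nOut := by
  induction P with
  | ite s t P Q hP hQ =>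
    have := Term.subst_name_eq_iff hf s t
    by_cases h : s = t
    · simp [Proc.rename, Proc.nOut, hP, h]
    · simp only [Proc.rename, Proc.nOut, hQ, if_neg h, if_neg (mt this.1 h)]
  | _ => simp_all [Proc.rename, Proc.nOut]

theorem Proc.minJoin_rename {f : Name → Name} (hf : Function.Injective f) (P : Proc) :
    (P.rename f).minJoin = P.minJoin := by
  induction P with
  | ite s t P Q hP hQ =>
    have := Term.subst_name_eq_iff hf s t
    by_cases h : s = t
    · simp [Proc.rename, Proc.minJoin, hP, h]
    · simp only [Proc.rename, Proc.minJoin, hQ, if_neg h, if_neg (mt this.1 h)]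
  | _ => simp_all [Proc.rename, Proc.minJoin]

theorem Alpha.nOut_eq {P Q : Proc} (h : Alpha P Q) : P.nOut = Q.nOut := by
  induction h with
  | convRes a b P _ => simp [Proc.nOut, Proc.nOut_rename (Equiv.swap a b).injective]
  | _ => simp_all [Proc.nOut]

theorem Alpha.minJoin_eq {P Q : Proc} (h : Alpha P Q) : P.minJoin = Q.minJoin := by
  induction h with
  | convRes a b P _ => simp [Proc.minJoin, Proc.minJoin_rename (Equiv.swap a b).injective]
  | _ => simp_all [Proc.minJoin]

theorem SCAxiom.nOut_eq {P Q : Proc} (h : SCAxiom P Q) : P.nOut = Q.nOut := by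
  cases h with
  | parComm => simp [Proc.nOut, add_comm]
  | parAssoc => simp [Proc.nOut, add_assoc]
  | alpha h => exact h.nOut_eq
  -- The count of a replication must solve `x = n + x`; in `ℕ∞` the product `⊤ * n` does so, being
  -- `0` for `n = 0` and `⊤` otherwise.
  | rep P =>
    simp only [Proc.nOut]
    by_cases h : P.nOut = 0
    · simp [h]
    · simp [ENat.top_mul h]
  | _ => simp_all [Proc.nOut]

theorem SCAxiom.minJoin_eq {P Q : Proc} (h : SCAxiom P Q) : P.minJoin = Q.minJoin := by
  cases h with
  | parComm => simp [Proc.minJoin, inf_comm]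
  | parAssoc => simp [Proc.minJoin, inf_assoc]
  | alpha h => exact h.minJoin_eq
  | _ => simp_all [Proc.minJoin]

theorem SC.nOut_eq {L : Lang} {P Q : Proc} (h : SC L P Q) : P.nOut = Q.nOut := by
  induction h with
  | ax _ _ h => exact h.nOut_eq
  | _ => simp_all [Proc.nOut]

theorem SC.minJoin_eq {L : Lang} {P Q : Proc} (h : SC L P Q) : P.minJoin = Q.minJoin := by
  induction h with
  | ax _ _ h => exact h.minJoin_eq
  | _ => simp_all [Proc.minJoin]

theorem nOut_parList (Ps : List Proc) (Q : Proc) :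
    (parList Ps Q).nOut = (Ps.map Proc.nOut).sum + Q.nOut := by
  induction Ps with
  | nil => simp [parList]
  | cons P Ps ih =>
    change P.nOut + (parList Ps Q).nOut = _
    rw [ih]; simp [add_assoc]

theorem minJoin_parList_le (Ps : List Proc) (Q : Proc) : (parList Ps Q).minJoin ≤ Q.minJoin := by
  induction Ps with
  | nil => simp [parList]
  | cons P Ps ih => exact inf_le_right.trans ih

/-- A reduction needs as many active outputs as some active join has inputs. -/
theorem Red.minJoin_le_nOut {L : Lang} {P Q : Proc} (h : Red L P Q) : P.minJoin ≤ P.nOut := by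
  induction h with
  | commA h hm =>
    -- The reacting join bounds the minimum, and its length is the number of outputs that it
    -- consumes.
    refine (minJoin_parList_le _ _).trans ?_
    simp [nOut_parList, Proc.minJoin, Proc.nOut, Function.comp_def, hm.length_eq]
  | commS h hm =>
    refine (minJoin_parList_le _ _).trans ?_
    have := hm.length_eq
    simp only [List.length_map] at this
    simp [nOut_parList, Proc.minJoin, Proc.nOut, Function.comp_def, this]
  | par _ _ ih => exact inf_le_left.trans (ih.trans (by simp [Proc.nOut]))
  | res a _ ih => exact ih
  | struct h _ _ ih => rwa [h.minJoin_eq, h.nOut_eq]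

/-! ### Capabilities of a process

A capability is an active output, an active input component or an active success process. Free
names are shifted by one, and restricted names are replaced by `0`. -/

inductive Cap
  | out (o : Out)
  | inp (i : Inp)
  | ok

/-- All binding names are sent to `0` as well, so capabilities do not notice α-conversion of an
input. As a consequence `c.map id` may differ from `c`. -/
def Cap.map (g : ℕ → ℕ) : Cap → Cap
  | .out o => .out (o.subst fun a => .name (g a))
  | .inp i => .inp (i.subst (fun _ => 0) fun a => .name (g a))
  | .ok => .ok

def Cap.names : Cap → Finset ℕ
  | .out o => o.names
  | .inp i => i.free
  | .ok => ∅

/-! ### Renaming of capabilities -/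

theorem Term.names_subst_name (g : ℕ → ℕ) (t : Term) :
    (t.subst fun a => .name (g a)).names = t.names.image g := by
  induction t with
  | name a => simp [Term.subst, Term.names]
  | comp s t hs ht => simp [Term.subst, Term.names, hs, ht, Finset.image_union]

theorem chNames_subst_name (g : ℕ → ℕ) (c : Option Term) :
    chNames (c.map (Term.subst fun a => .name (g a))) = (chNames c).image g := by
  cases c with
  | none => rfl
  | some t => exact t.names_subst_name g

theorem Pat.free_subst_name (ρ g : ℕ → ℕ) (p : Pat) :
    (p.subst ρ fun a => .name (g a)).free = p.free.image g := by
  induction p with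
  | bind x => rfl
  | mtch a => simp [Pat.subst, Term.toPat, Pat.free]
  | comp p q hp hq => simp [Pat.subst, Pat.free, hp, hq, Finset.image_union]

theorem Out.names_subst_name (g : ℕ → ℕ) (o : Out) :
    (o.subst fun a => .name (g a)).names = o.names.image g := by
  obtain ⟨c, d⟩ := o
  simp only [Out.names, Out.subst, chNames_subst_name, Finset.image_union]
  congr 1
  induction d with
  | nil => rfl
  | cons t d ih => simp [Term.names_subst_name, ih, Finset.image_union]

theorem Inp.free_subst_name (ρ g : ℕ → ℕ) (i : Inp) :
    (i.subst ρ fun a => .name (g a)).free = i.free.image g := by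
  obtain ⟨c, d⟩ := i
  simp only [Inp.free, Inp.subst, chNames_subst_name, Finset.image_union]
  congr 1
  induction d with
  | nil => rfl
  | cons t d ih => simp [Pat.free_subst_name, ih, Finset.image_union]

theorem Cap.names_map (g : ℕ → ℕ) (c : Cap) : (c.map g).names = c.names.image g := by
  cases c with
  | out o => exact o.names_subst_name g
  | inp i => exact i.free_subst_name _ g
  | ok => rfl

theorem Pat.subst_subst_name (ρ ρ' g g' : ℕ → ℕ) (p : Pat) :
    (p.subst ρ fun a => .name (g a)).subst ρ' (fun a => .name (g' a)) =
      p.subst (fun a => ρ' (ρ a)) fun a => .name (g' (g a)) := by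
  induction p with
  | bind x => rfl
  | mtch a => rfl
  | comp p q hp hq => simp [Pat.subst, hp, hq]

theorem Out.subst_subst_name (g g' : ℕ → ℕ) (o : Out) :
    (o.subst fun a => .name (g a)).subst (fun a => .name (g' a)) =
      o.subst fun a => .name (g' (g a)) := by
  obtain ⟨c, d⟩ := o
  cases c <;> simp [Out.subst, Term.subst_subst, Function.comp_def, Term.subst]

theorem Inp.subst_subst_name (ρ ρ' g g' : ℕ → ℕ) (i : Inp) :
    (i.subst ρ fun a => .name (g a)).subst ρ' (fun a => .name (g' a)) =
      i.subst (fun a => ρ' (ρ a)) fun a => .name (g' (g a)) := by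
  obtain ⟨c, d⟩ := i
  cases c <;> simp [Inp.subst, Term.subst_subst, Function.comp_def, Term.subst,
    Pat.subst_subst_name]

theorem Cap.map_map (g g' : ℕ → ℕ) (c : Cap) : (c.map g).map g' = c.map fun a => g' (g a) := by
  cases c with
  | out o => simp [Cap.map, Out.subst_subst_name]
  | inp i => simp [Cap.map, Inp.subst_subst_name]
  | ok => rfl

theorem chMap_congr {σ τ : Name → Term} {c : Option Term}
    (h : ∀ a ∈ chNames c, σ a = τ a) : c.map (Term.subst σ) = c.map (Term.subst τ) := by
  cases c with
  | none => rfl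
  | some t => exact congrArg some (Term.subst_congr h)

theorem Pat.subst_congr {ρ : Name → Name} {σ τ : Name → Term} {p : Pat}
    (h : ∀ a ∈ p.free, σ a = τ a) : p.subst ρ σ = p.subst ρ τ := by
  induction p with
  | bind x => rfl
  | mtch a => simp [Pat.subst, h a (by simp [Pat.free])]
  | comp p q hp hq =>
    simp only [Pat.free, Finset.mem_union] at h
    simp [Pat.subst, hp fun a ha => h a (.inl ha), hq fun a ha => h a (.inr ha)]

theorem Out.subst_congr {σ τ : Name → Term} {o : Out} (h : ∀ a ∈ o.names, σ a = τ a) :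
    o.subst σ = o.subst τ := by
  obtain ⟨c, d⟩ := o
  simp only [Out.names, Finset.mem_union] at h
  simp only [Out.subst, Out.mk.injEq]
  refine ⟨chMap_congr fun a ha => h a (.inl ha), ?_⟩
  replace h := fun a ha => h a (.inr ha)
  induction d with
  | nil => rfl
  | cons t d ih =>
    simp only [List.foldr_cons, Finset.mem_union] at h
    simp only [List.map_cons, Term.subst_congr fun a ha => h a (.inl ha),
      ih fun a ha => h a (.inr ha)]

theorem Inp.subst_congr {ρ : Name → Name} {σ τ : Name → Term} {i : Inp}
    (h : ∀ a ∈ i.free, σ a = τ a) : i.subst ρ σ = i.subst ρ τ := by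
  obtain ⟨c, d⟩ := i
  simp only [Inp.free, Finset.mem_union] at h
  simp only [Inp.subst, Inp.mk.injEq]
  refine ⟨chMap_congr fun a ha => h a (.inl ha), ?_⟩
  replace h := fun a ha => h a (.inr ha)
  induction d with
  | nil => rfl
  | cons t d ih =>
    simp only [List.foldr_cons, Finset.mem_union] at h
    simp only [List.map_cons, Pat.subst_congr fun a ha => h a (.inl ha),
      ih fun a ha => h a (.inr ha)]

theorem Cap.map_congr {g g' : ℕ → ℕ} {c : Cap} (h : ∀ a ∈ c.names, g a = g' a) :
    c.map g = c.map g' := by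
  cases c with
  | out o => exact congrArg _ (Out.subst_congr fun a ha => congrArg _ (h a ha))
  | inp i => exact congrArg _ (Inp.subst_congr fun a ha => congrArg _ (h a ha))
  | ok => rfl

/-- Replace the shifted name `a` by `0`. -/
def hide (a : Name) (x : ℕ) : ℕ := if x = a + 1 then 0 else x

/-- Rename shifted names. -/
def lift (f : Name → Name) : ℕ → ℕ
  | 0 => 0
  | a + 1 => f a + 1

theorem lift_injective {f : Name → Name} (hf : Function.Injective f) :
    Function.Injective (lift f) := by
  intro x y h
  cases x <;> cases y <;> simp_all [lift, hf.eq_iff]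

/-- The capabilities of a process. -/
def Proc.acts : Proc → Set Cap
  | .nil => ∅
  | .ok => {.ok}
  | .par P Q => P.acts ∪ Q.acts
  | .res a P => Cap.map (hide a) '' P.acts
  | .ite s t P Q => {c | s = t ∧ c ∈ P.acts ∨ s ≠ t ∧ c ∈ Q.acts}
  | .rep P => P.acts
  | .aout o => {(Cap.out o).map Nat.succ}
  | .sout o _ => {(Cap.out o).map Nat.succ}
  | .inp I _ => {c | ∃ i ∈ I, c = (Cap.inp i).map Nat.succ}

theorem inp_free_subset {I : List Inp} {i : Inp} (h : i ∈ I) : i.free ⊆ inpFree I := by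
  induction I with
  | nil => cases h
  | cons j I ih =>
    intro a ha
    rcases List.mem_cons.1 h with rfl | h
    · exact Finset.mem_union_left _ ha
    · exact Finset.mem_union_right _ (ih h ha)

/-- Translates the freshness conditions of α-conversion and scope extrusion, which speak of free
names, into statements about capabilities. -/
theorem Proc.names_acts {P : Proc} {c : Cap} (h : c ∈ P.acts) {a : Name}
    (ha : a + 1 ∈ c.names) : a ∈ P.fn := by
  induction P generalizing c a with
  | nil => cases h
  | ok => cases h; simp [Cap.names] at ha
  | par P Q hP hQ =>
    rcases h with h | h
    · exact Finset.mem_union_left _ (hP h ha)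
    · exact Finset.mem_union_right _ (hQ h ha)
  | res b P hP =>
    obtain ⟨c, hc, rfl⟩ := h
    rw [Cap.names_map, Finset.mem_image] at ha
    obtain ⟨x, hx, hxa⟩ := ha
    unfold hide at hxa
    split at hxa
    · exact absurd hxa.symm (Nat.succ_ne_zero a)
    · rename_i hne
      subst hxa
      exact Finset.mem_erase.2 ⟨fun h => hne (by rw [h]), hP hc hx⟩
  | ite s t P Q hP hQ =>
    rcases h with ⟨_, h⟩ | ⟨_, h⟩
    · simp [Proc.fn, hP h ha]
    · simp [Proc.fn, hQ h ha]
  | rep P hP => exact hP h ha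
  | aout o =>
    cases h
    rw [Cap.names_map] at ha
    change a ∈ o.names
    simpa [Cap.names] using ha
  | sout o P hP =>
    cases h
    rw [Cap.names_map] at ha
    exact Finset.mem_union_left _ (by simpa [Cap.names] using ha)
  | inp I P hP =>
    obtain ⟨i, hi, rfl⟩ := h
    rw [Cap.names_map] at ha
    exact Finset.mem_union_left _ (inp_free_subset hi (by simpa [Cap.names] using ha))

/-- Each capability of a process arises from `Cap.map` (or is success), so its binding names have
been erased already. -/
theorem Proc.map_id_of_mem_acts {P : Proc} {c : Cap} (h : c ∈ P.acts) : c.map id = c := by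
  induction P generalizing c with
  | nil => cases h
  | ok => cases h; rfl
  | par P Q hP hQ => exact h.elim hP hQ
  | res b P hP =>
    obtain ⟨c, -, rfl⟩ := h
    exact Cap.map_map _ _ c
  | ite s t P Q hP hQ => exact h.elim (fun h => hP h.2) fun h => hQ h.2
  | rep P hP => exact hP h
  | aout o => cases h; exact Cap.map_map _ _ _
  | sout o P => cases h; exact Cap.map_map _ _ _
  | inp I P =>
    obtain ⟨i, -, rfl⟩ := h
    exact Cap.map_map _ _ _

/-- Injectivity keeps the outcome of every conditional and prevents another name from being
identified with a restricted one. -/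
theorem Proc.acts_rename {f : Name → Name} (hf : Function.Injective f) (P : Proc) :
    (P.rename f).acts = Cap.map (lift f) '' P.acts := by
  induction P with
  | nil => simp [Proc.rename, Proc.acts]
  | ok => simp [Proc.rename, Proc.acts, Cap.map]
  | par P Q hP hQ => simp [Proc.rename, Proc.acts, hP, hQ, Set.image_union]
  | res a P hP =>
    simp only [Proc.rename, Proc.acts, hP, Set.image_image, Cap.map_map]
    congr! 3 with c x
    rename_i x
    cases x with
    | zero => simp [hide, lift]
    | succ x => by_cases h : x = a <;> simp [hide, lift, h, hf.eq_iff]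
  | ite s t P Q hP hQ =>
    ext c
    by_cases h : s = t
    · simp [Proc.rename, Proc.acts, hP, h]
    · have h' := mt (Term.subst_name_eq_iff hf s t).1 h
      simp [Proc.rename, Proc.acts, hQ, h, h']
  | rep P hP => exact hP
  | aout o => simp [Proc.rename, Proc.acts, Cap.map, Out.subst_subst_name, lift]
  | sout o P hP => simp [Proc.rename, Proc.acts, Cap.map, Out.subst_subst_name, lift]
  | inp I P hP =>
    ext c
    simp only [Proc.rename, Proc.acts, Cap.map, Set.mem_ofPred_eq, List.mem_map, Set.mem_image]
    constructor
    · rintro ⟨_, ⟨i, hi, rfl⟩, rfl⟩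
      exact ⟨_, ⟨i, hi, rfl⟩, by simp [Inp.subst_subst_name, lift]⟩
    · rintro ⟨_, ⟨i, hi, rfl⟩, rfl⟩
      exact ⟨_, ⟨i, hi, rfl⟩, by simp [Inp.subst_subst_name, lift]⟩

/-! ### Interaction of capabilities -/

/-- An output and an input component match without comparing restricted names. -/
def Fits (o : Out) (i : Inp) : Prop :=
  o.ch = i.ch ∧ (∃ σ, PolyMatch o.data i.pats σ) ∧ 0 ∉ i.free

/-- Symmetric by design, because either side of a parallel composition may hold the output. -/
def React : Cap → Cap → Prop
  | .out o, .inp i => Fits o i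
  | .inp i, .out o => Fits o i
  | _, _ => False

def Cross (A B : Set Cap) : Prop := ∃ c ∈ A, ∃ d ∈ B, React c d

theorem React.symm {c d : Cap} (h : React c d) : React d c := by
  cases c <;> cases d <;> exact h

theorem Cross.symm {A B : Set Cap} (h : Cross A B) : Cross B A := by
  obtain ⟨c, hc, d, hd, h⟩ := h
  exact ⟨d, hd, c, hc, h.symm⟩

theorem cross_comm {A B : Set Cap} : Cross A B ↔ Cross B A := ⟨.symm, .symm⟩

theorem cross_union_left {A B C : Set Cap} : Cross (A ∪ B) C ↔ Cross A C ∨ Cross B C := by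
  simp only [Cross, Set.mem_union, or_and_right, exists_or]

theorem cross_union_right {A B C : Set Cap} : Cross A (B ∪ C) ↔ Cross A B ∨ Cross A C := by
  rw [cross_comm, cross_union_left, cross_comm, @cross_comm C]

/-! ### Matching under renaming and hiding of names -/

theorem Match.free_subset {t : Term} {p : Pat} {σ : Subst} (h : Match t p σ) :
    p.free ⊆ t.names := by
  induction h with
  | bind => simp [Pat.free]
  | mtch => simp [Pat.free, Term.names]
  | comp _ _ h₁ h₂ => exact Finset.union_subset_union h₁ h₂

/-- An input tests names only for equality with names of the output, so a name absent from the
output plays no part in a successful match. -/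
theorem Fits.free_subset {o : Out} {i : Inp} (h : Fits o i) : i.free ⊆ o.names := by
  obtain ⟨hc, ⟨σ, hm⟩, -⟩ := h
  unfold Inp.free Out.names
  rw [hc]
  refine Finset.union_subset_union subset_rfl ?_
  generalize o.data = d at hm
  generalize i.pats = p at hm
  induction hm with
  | nil => simp
  | cons h _ ih => exact Finset.union_subset_union h.free_subset ih

theorem Match.map {t : Term} {p : Pat} {σ : Subst} (ρ g : ℕ → ℕ) (h : Match t p σ) :
    ∃ τ, Match (t.subst fun a => .name (g a)) (p.subst ρ fun a => .name (g a)) τ := by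
  induction h with
  | bind t x => exact ⟨_, .bind _ _⟩
  | mtch a => exact ⟨_, .mtch _⟩
  | comp _ _ h₁ h₂ =>
    obtain ⟨_, h₁⟩ := h₁
    obtain ⟨_, h₂⟩ := h₂
    exact ⟨_, .comp h₁ h₂⟩

theorem Fits.of_polyMatch {o : Out} {i : Inp} {σ : Subst} (ρ g : ℕ → ℕ) (hc : o.ch = i.ch)
    (hm : PolyMatch o.data i.pats σ) (h₀ : ∀ a ∈ i.free, g a ≠ 0) :
    Fits (o.subst fun a => .name (g a)) (i.subst ρ fun a => .name (g a)) := by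
  refine ⟨by simp [Out.subst, Inp.subst, hc], ?_, ?_⟩
  · simp only [Out.subst, Inp.subst]
    generalize o.data = d at hm
    generalize i.pats = p at hm
    induction hm with
    | nil => exact ⟨_, .nil⟩
    | cons h _ ih =>
      obtain ⟨_, h⟩ := h.map ρ g
      obtain ⟨_, ih⟩ := ih
      exact ⟨_, .cons h ih⟩
  · rw [Inp.free_subst_name, Finset.mem_image]
    rintro ⟨a, ha, h⟩
    exact h₀ a ha h

theorem Fits.map {o : Out} {i : Inp} (ρ g : ℕ → ℕ) (h : Fits o i)
    (h₀ : ∀ a ∈ i.free, g a ≠ 0) :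
    Fits (o.subst fun a => .name (g a)) (i.subst ρ fun a => .name (g a)) := by
  obtain ⟨hc, ⟨σ, hm⟩, -⟩ := h
  exact .of_polyMatch ρ g hc hm h₀

/-- Two renamings are needed because output and input may lie under different restrictions. Names
can be confused only at the value `0`, which `h₀` excludes. -/
theorem Term.eq_of_subst_name {g₁ g₂ : ℕ → ℕ} (hg : ∀ x y, g₁ x = g₂ y → g₁ x ≠ 0 → x = y)
    {s t : Term} (h : (s.subst fun a => .name (g₁ a)) = t.subst fun a => .name (g₂ a))
    (h₀ : ∀ a ∈ t.names, g₂ a ≠ 0) : s = t := by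
  induction s generalizing t with
  | name a =>
    cases t with
    | name b =>
      simp only [Term.subst, Term.name.injEq] at h
      rw [hg a b h (h ▸ h₀ b (by simp [Term.names]))]
    | comp t₁ t₂ => simp [Term.subst] at h
  | comp s₁ s₂ h₁ h₂ =>
    cases t with
    | name b => simp [Term.subst] at h
    | comp t₁ t₂ =>
      simp only [Term.subst, Term.comp.injEq] at h
      simp only [Term.names, Finset.mem_union] at h₀
      rw [h₁ h.1 fun a ha => h₀ a (.inl ha), h₂ h.2 fun a ha => h₀ a (.inr ha)]

theorem Match.of_map {g₁ g₂ ρ : ℕ → ℕ} (hg : ∀ x y, g₁ x = g₂ y → g₁ x ≠ 0 → x = y)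
    {t : Term} {p : Pat} {σ : Subst}
    (h : Match (t.subst fun a => .name (g₁ a)) (p.subst ρ fun a => .name (g₂ a)) σ)
    (h₀ : ∀ a ∈ p.free, g₂ a ≠ 0) : ∃ τ, Match t p τ := by
  induction p generalizing t σ with
  | bind x => exact ⟨_, .bind _ _⟩
  | mtch b =>
    cases t with
    | name a =>
      simp only [Term.subst, Pat.subst, Term.toPat] at h
      generalize hx : g₁ a = x at h
      generalize hy : g₂ b = y at h
      cases h
      have : a = b := hg a b (hx.trans hy.symm) (by
        rw [hx, ← hy]; exact h₀ b (by simp [Pat.free]))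
      subst this
      exact ⟨_, .mtch _⟩
    | comp t₁ t₂ =>
      simp only [Term.subst, Pat.subst, Term.toPat] at h
      cases h
  | comp p q hp hq =>
    cases t with
    | name a =>
      simp only [Term.subst, Pat.subst] at h
      cases h
    | comp t₁ t₂ =>
      simp only [Term.subst, Pat.subst] at h
      simp only [Pat.free, Finset.mem_union] at h₀
      cases h with
      | comp h₁ h₂ =>
        obtain ⟨_, h₁⟩ := hp h₁ fun a ha => h₀ a (.inl ha)
        obtain ⟨_, h₂⟩ := hq h₂ fun a ha => h₀ a (.inr ha)
        exact ⟨_, .comp h₁ h₂⟩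

theorem Fits.of_map {g₁ g₂ ρ : ℕ → ℕ} (hg : ∀ x y, g₁ x = g₂ y → g₁ x ≠ 0 → x = y)
    {o : Out} {i : Inp}
    (h : Fits (o.subst fun a => .name (g₁ a)) (i.subst ρ fun a => .name (g₂ a))) :
    o.ch = i.ch ∧ (∃ σ, PolyMatch o.data i.pats σ) ∧ ∀ a ∈ i.free, g₂ a ≠ 0 := by
  obtain ⟨hc, ⟨σ, hm⟩, h₀⟩ := h
  rw [Inp.free_subst_name, Finset.mem_image] at h₀
  have h₁ : ∀ a ∈ i.free, g₂ a ≠ 0 := fun a ha h => h₀ ⟨a, ha, h⟩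
  refine ⟨?_, ?_, h₁⟩
  · replace h₁ := fun a ha => h₁ a (Finset.mem_union_left _ ha)
    simp only [Out.subst, Inp.subst] at hc
    cases ho : o.ch <;> cases hi : i.ch <;> simp only [ho, hi, Option.map, reduceCtorEq] at hc
    · rfl
    · rw [hi] at h₁
      rw [Term.eq_of_subst_name hg (Option.some.inj hc) h₁]
  · replace h₁ := fun a ha => h₁ a (Finset.mem_union_right _ ha)
    simp only [Out.subst, Inp.subst] at hm
    generalize o.data = d at hm
    generalize i.pats = p at hm h₁
    induction p generalizing d σ with
    | nil =>
      cases d with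
      | nil => exact ⟨_, .nil⟩
      | cons t d => cases hm
    | cons q p ih =>
      cases d with
      | nil => cases hm
      | cons t d =>
        simp only [List.foldr_cons, Finset.mem_union] at h₁
        cases hm with
        | cons h h' =>
          obtain ⟨_, h⟩ := h.of_map hg fun a ha => h₁ a (.inl ha)
          obtain ⟨_, h'⟩ := ih _ _ h' fun a ha => h₁ a (.inr ha)
          exact ⟨_, .cons h h'⟩

theorem Fits.of_map_self {g ρ : ℕ → ℕ} (hg : ∀ x y, g x = g y → g x ≠ 0 → x = y) (h₀ : g 0 = 0)
    {o : Out} {i : Inp}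
    (h : Fits (o.subst fun a => .name (g a)) (i.subst ρ fun a => .name (g a))) : Fits o i := by
  obtain ⟨h₁, h₂, h₃⟩ := h.of_map hg
  exact ⟨h₁, h₂, fun h => h₃ 0 h h₀⟩

theorem React.of_map {g : ℕ → ℕ} (hg : ∀ x y, g x = g y → g x ≠ 0 → x = y) (h₀ : g 0 = 0)
    {c d : Cap} (h : React (c.map g) (d.map g)) : React c d := by
  cases c <;> cases d <;> first | exact h.elim | exact Fits.of_map_self hg h₀ h

/-- Patterns have no inequality tests, so any renaming preserves a match. What must be prevented is
that a compared name becomes restricted, and compared names occur on both sides. -/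
theorem React.map {g : ℕ → ℕ} {c d : Cap} (h : React c d)
    (h₀ : ∀ a ∈ c.names, a ∈ d.names → a ≠ 0 → g a ≠ 0) : React (c.map g) (d.map g) := by
  cases c <;> cases d <;> try exact h.elim
  · exact Fits.map (fun _ => 0) g h fun a ha =>
      h₀ a (Fits.free_subset h ha) ha fun h' => h.2.2 (h' ▸ ha)
  · exact Fits.map (fun _ => 0) g h fun a ha =>
      h₀ a ha (Fits.free_subset h ha) fun h' => h.2.2 (h' ▸ ha)

theorem hide_injOn (a x y : ℕ) (h : hide a x = hide a y) (h₀ : hide a x ≠ 0) : x = y := by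
  unfold hide at *
  split at h <;> split at h <;> simp_all

/-- A partner in which `a` does not occur never compares `a`, so restricting `a` on the other side
is invisible to it. This is the content of scope extrusion for capabilities: a restricted name may
be sent, but not tested from outside. -/
theorem React.hide_right_iff {a : Name} {c d : Cap} (hc : a + 1 ∉ c.names) :
    React c (d.map (hide a)) ↔ React c d := by
  have hne : ∀ x ∈ c.names, x ≠ a + 1 := fun x hx h => hc (h ▸ hx)
  have hd : (d.map (hide a)).map (hide a) = d.map (hide a) := by
    rw [Cap.map_map]
    congr 1
    funext x
    unfold hide
    split <;> simp_all
  constructor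
  · intro h
    refine React.of_map (hide_injOn a) rfl ?_
    rw [← hd]
    refine h.map fun x hx _ h₀ => ?_
    simpa [hide, hne x hx] using h₀
  · intro h
    -- `c` may still carry binding names that `Cap.map` erases; only after applying `id` does it
    -- agree with `c.map (hide a)`.
    refine React.of_map (g := id) (fun _ _ h _ => h) rfl ?_
    have h₁ : c.map id = c.map (hide a) :=
      Cap.map_congr fun x hx => by simp [hide, hne x hx]
    rw [h₁, Cap.map_map]
    refine h.map fun x hx _ h₀ => ?_
    simpa [hide, hne x hx] using h₀

theorem cross_image {g : ℕ → ℕ} (hg : Function.Injective g) (h₀ : g 0 = 0) {A B : Set Cap} :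
    Cross (Cap.map g '' A) (Cap.map g '' B) ↔ Cross A B := by
  constructor
  · rintro ⟨_, ⟨c, hc, rfl⟩, _, ⟨d, hd, rfl⟩, h⟩
    exact ⟨c, hc, d, hd, h.of_map (fun x y h _ => hg h) h₀⟩
  · rintro ⟨c, hc, d, hd, h⟩
    exact ⟨_, ⟨c, hc, rfl⟩, _, ⟨d, hd, rfl⟩, h.map fun a _ _ h => h₀ ▸ hg.ne h⟩

/-- Two active prefixes of the process match, as in a binary interaction. -/
def Proc.CanReact : Proc → Prop
  | .par P Q => P.CanReact ∨ Q.CanReact ∨ Cross P.acts Q.acts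
  | .res _ P => P.CanReact
  | .ite s t P Q => s = t ∧ P.CanReact ∨ s ≠ t ∧ Q.CanReact
  | .rep P => P.CanReact ∨ Cross P.acts P.acts
  | _ => False

theorem Proc.canReact_rename {f : Name → Name} (hf : Function.Injective f) (P : Proc) :
    (P.rename f).CanReact ↔ P.CanReact := by
  induction P with
  | par P Q hP hQ =>
    simp [Proc.rename, Proc.CanReact, hP, hQ, Proc.acts_rename hf,
      cross_image (lift_injective hf) rfl]
  | res a P hP => exact hP
  | ite s t P Q hP hQ =>
    have := Term.subst_name_eq_iff hf s t
    by_cases h : s = t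
    · simp [Proc.rename, Proc.CanReact, hP, h]
    · have h' := mt this.1 h
      simp [Proc.rename, Proc.CanReact, hQ, h, h']
  | rep P hP =>
    simp [Proc.rename, Proc.CanReact, hP, Proc.acts_rename hf,
      cross_image (lift_injective hf) rfl]
  | _ => rfl


/-! ### Invariance of capabilities and interactions under structural equivalence -/

theorem Alpha.acts_eq {P Q : Proc} (h : Alpha P Q) :
    P.acts = Q.acts ∧ (P.CanReact ↔ Q.CanReact) := by
  induction h with
  | refl => exact ⟨rfl, Iff.rfl⟩
  | symm _ ih => exact ⟨ih.1.symm, ih.2.symm⟩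
  | trans _ _ ih₁ ih₂ => exact ⟨ih₁.1.trans ih₂.1, ih₁.2.trans ih₂.2⟩
  | par _ _ ih₁ ih₂ => simp [Proc.acts, Proc.CanReact, ih₁, ih₂]
  | res a _ ih => simp [Proc.acts, Proc.CanReact, ih]
  | ite s t _ _ ih₁ ih₂ => simp [Proc.acts, Proc.CanReact, ih₁, ih₂]
  | rep _ ih => simp [Proc.acts, Proc.CanReact, ih]
  | sout => exact ⟨rfl, Iff.rfl⟩
  | inp => exact ⟨rfl, Iff.rfl⟩
  | convRes a b P hb =>
    refine ⟨?_, (Proc.canReact_rename (Equiv.swap a b).injective P).symm⟩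
    simp only [Proc.acts, Proc.acts_rename (Equiv.swap a b).injective, Set.image_image,
      Cap.map_map]
    refine Set.image_congr fun c hc => Cap.map_congr fun x hx => ?_
    cases x with
    | zero => rfl
    | succ x =>
      -- As `b` is not free in `P`, the only name that becomes `b` under the swap is `a`, and both
      -- are hidden.
      have hxb : x ≠ b := fun h => hb (h ▸ Proc.names_acts hc hx)
      by_cases hxa : x = a
      · simp [hide, lift, hxa]
      · simp [hide, lift, hxa, hxb, Equiv.swap_apply_of_ne_of_ne hxa hxb]
  | convInp a b I P =>
    refine ⟨?_, Iff.rfl⟩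
    have key : ∀ i : Inp, (Cap.inp (i.subst (Equiv.swap a b) Term.name)).map Nat.succ =
        (Cap.inp i).map Nat.succ := fun i => by
      simp only [Cap.map]
      rw [show (Term.name : Name → Term) = fun a => .name (id a) from rfl, Inp.subst_subst_name]
      rfl
    ext c
    simp only [Proc.acts, Set.mem_ofPred_eq, List.mem_map]
    constructor
    · rintro ⟨i, hi, rfl⟩
      exact ⟨_, ⟨i, hi, rfl⟩, (key i).symm⟩
    · rintro ⟨_, ⟨i, hi, rfl⟩, rfl⟩
      exact ⟨i, hi, key i⟩

theorem SCAxiom.acts_eq {P Q : Proc} (h : SCAxiom P Q) :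
    P.acts = Q.acts ∧ (P.CanReact ↔ Q.CanReact) := by
  cases h with
  | parNil => simp [Proc.acts, Proc.CanReact, Cross]
  | parComm P Q =>
    refine ⟨Set.union_comm _ _, ?_⟩
    simp only [Proc.CanReact, cross_comm (A := P.acts)]
    tauto
  | parAssoc P Q R =>
    refine ⟨(Set.union_assoc _ _ _).symm, ?_⟩
    simp only [Proc.CanReact, Proc.acts, cross_union_left, cross_union_right]
    tauto
  | iteEq s t P Q h => simp [Proc.acts, Proc.CanReact, h]
  | iteNe s t P Q h => simp [Proc.acts, Proc.CanReact, h]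
  | alpha h => exact h.acts_eq
  | resNil => simp [Proc.acts, Proc.CanReact]
  | resComm a b P =>
    refine ⟨?_, Iff.rfl⟩
    simp only [Proc.acts, Set.image_image, Cap.map_map]
    congr! 3 with c x
    rename_i x
    simp only [hide]
    split_ifs <;> simp_all
  | scope a P Q ha =>
    have hn : ∀ c ∈ P.acts, a + 1 ∉ c.names := fun c hc h => ha (Proc.names_acts hc h)
    have hP : Cap.map (hide a) '' P.acts = P.acts := by
      conv_rhs => rw [← Set.image_id P.acts]
      refine Set.image_congr fun c hc => ?_
      refine (Cap.map_congr fun x hx => ?_).trans (Proc.map_id_of_mem_acts hc)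
      have : x ≠ a + 1 := fun h => hn c hc (h ▸ hx)
      simp [hide, this]
    refine ⟨by simp [Proc.acts, Set.image_union, hP], ?_⟩
    have hc : Cross P.acts (Cap.map (hide a) '' Q.acts) ↔ Cross P.acts Q.acts := by
      constructor
      · rintro ⟨c, hc, _, ⟨d, hd, rfl⟩, h⟩
        exact ⟨c, hc, d, hd, (React.hide_right_iff (hn c hc)).1 h⟩
      · rintro ⟨c, hc, d, hd, h⟩
        exact ⟨c, hc, _, ⟨d, hd, rfl⟩, (React.hide_right_iff (hn c hc)).2 h⟩
    simp only [Proc.CanReact, Proc.acts, hc]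
  -- Unfolding creates an interaction between `P` and another copy of it, which `CanReact` of the
  -- replication already counts.
  | rep P =>
    refine ⟨(Set.union_self _).symm, ?_⟩
    simp only [Proc.CanReact, Proc.acts]
    tauto

theorem SC.acts_eq {L : Lang} {P Q : Proc} (h : SC L P Q) :
    P.acts = Q.acts ∧ (P.CanReact ↔ Q.CanReact) := by
  induction h with
  | ax _ _ h => exact h.acts_eq
  | refl => exact ⟨rfl, Iff.rfl⟩
  | symm _ ih => exact ⟨ih.1.symm, ih.2.symm⟩
  | trans _ _ ih₁ ih₂ => exact ⟨ih₁.1.trans ih₂.1, ih₁.2.trans ih₂.2⟩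
  | par _ _ ih₁ ih₂ => simp [Proc.acts, Proc.CanReact, ih₁, ih₂]
  | res a _ ih => simp [Proc.acts, Proc.CanReact, ih]
  | ite s t _ _ ih₁ ih₂ => simp [Proc.acts, Proc.CanReact, ih₁, ih₂]
  | rep _ ih => simp [Proc.acts, Proc.CanReact, ih]
  | sout => exact ⟨rfl, Iff.rfl⟩

theorem JoinMatch.canReact {os : List Out} {i : Inp} {σ : Subst} (h : JoinMatch os [i] σ) :
    ∃ o, os = [o] ∧ React ((Cap.out o).map Nat.succ) ((Cap.inp i).map Nat.succ) := by
  cases h with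
  | @cons o _ os _ σ₁ σ₂ hc hm hj =>
    cases hj
    refine ⟨o, rfl, ?_⟩
    -- The shift by one never yields `0`, so no name of a top-level prefix counts as restricted.
    exact Fits.of_polyMatch _ _ hc hm fun a _ => Nat.succ_ne_zero a

/-- In a binary language, a reduction comes from two matching active prefixes. -/
theorem Red.canReact {L : Lang} (hL : L.coord = .B) {P Q : Proc} (h : Red L P Q) :
    P.CanReact := by
  induction h with
  | @commA os I σ Q h hm =>
    have hI := (parList_wf.1 h).2.1
    rw [Lang.JoinOK, hL, List.length_eq_one_iff] at hI
    obtain ⟨i, rfl⟩ := hI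
    obtain ⟨o, rfl, hr⟩ := hm.canReact
    exact .inr (.inr ⟨_, rfl, _, ⟨i, by simp, rfl⟩, hr⟩)
  | @commS os I σ Q h hm =>
    have hI := (parList_wf.1 h).2.1
    rw [Lang.JoinOK, hL, List.length_eq_one_iff] at hI
    obtain ⟨i, rfl⟩ := hI
    obtain ⟨o, ho, hr⟩ := hm.canReact
    obtain ⟨⟨_, P⟩, rfl, rfl⟩ := List.map_eq_singleton_iff.1 ho
    exact .inr (.inr ⟨_, rfl, _, ⟨i, by simp, rfl⟩, hr⟩)
  | par _ _ ih => exact .inl ih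
  | res a _ ih => exact ih
  | struct h _ _ ih => exact h.acts_eq.2.2 ih

/-! ### Exposing a capability -/

/-- The processes that offer a capability at the top level. -/
def Proc.IsPrefix : Proc → Prop
  | .ok => True
  | .aout _ => True
  | .sout _ _ => True
  | .inp _ _ => True
  | _ => False

theorem Proc.IsPrefix.rename {P : Proc} (h : P.IsPrefix) (f : Name → Name) :
    (P.rename f).IsPrefix := by
  cases P <;> exact h

/-- Replace all shifted names from a list by `0`. -/
def hideAll (A : List Name) (x : ℕ) : ℕ := if ∃ a ∈ A, x = a + 1 then 0 else x

theorem hideAll_nil : hideAll [] = id := funext fun x => by simp [hideAll]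

theorem hideAll_cons (a : Name) (A : List Name) (x : ℕ) :
    hideAll (a :: A) x = hide a (hideAll A x) := by
  simp only [hideAll, hide, List.mem_cons, exists_eq_or_imp]
  split_ifs <;> simp_all

/-- Up to structural equivalence, a prefix of `P` that offers the capability `c` is exposed under
restrictions of names outside `N`. -/
def Lang.Exposes (L : Lang) (N : Finset Name) (P : Proc) (c : Cap) : Prop :=
  ∃ (A : List Name) (X P' : Proc), X.IsPrefix ∧ (∀ a ∈ A, a ∉ N) ∧
    SC L P (resList A (.par X P')) ∧ ∃ d ∈ X.acts, c = d.map (hideAll A)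

variable {L : Lang} {N : Finset Name} {P Q : Proc} {c : Cap}

theorem Lang.Exposes.of_sc (h : SC L P Q) (hQ : L.Exposes N Q c) : L.Exposes N P c := by
  obtain ⟨A, X, P', hX, hA, hP, hc⟩ := hQ
  exact ⟨A, X, P', hX, hA, h.trans hP, hc⟩

theorem Lang.Exposes.of_isPrefix (hP : L.WF P) (hX : P.IsPrefix) (hc : c ∈ P.acts) :
    L.Exposes N P c := by
  refine ⟨[], P, .nil, hX, by simp, (SC.parNil hP).symm, c, hc, ?_⟩
  rw [hideAll_nil, Proc.map_id_of_mem_acts hc]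

/-- The restrictions above the prefix avoid the free names of `Q`, so `Q` can be moved under them.
-/
theorem Lang.Exposes.par_left (hQ : L.WF Q) (h : L.Exposes (N ∪ Q.fn) P c) :
    L.Exposes N (.par P Q) c := by
  obtain ⟨A, X, P', hX, hA, hP, h⟩ := h
  have hXP : L.WF (.par X P') := resList_wf.1 hP.wf.2
  refine ⟨A, X, .par P' Q, hX, fun a ha hN => hA a ha (by simp [hN]), ?_, h⟩
  refine ((hP.par (.refl hQ)).trans (SC.parComm (resList_wf.2 hXP) hQ)).trans ?_
  refine (SC.extrude hQ hXP fun a ha hN => hA a ha (by simp [hN])).trans (SC.resList A ?_)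
  exact (SC.parComm hQ hXP).trans (SC.parAssoc hXP.1 hXP.2 hQ).symm

/-- The name `a` may belong to the set to be avoided, so it is α-converted to a fresh `b`. Requiring
the inner restrictions to avoid `a` ensures that the swap of `a` and `b` leaves them unchanged. -/
theorem Lang.Exposes.res {a : Name} (h : L.Exposes (insert a N) P c) :
    L.Exposes N (.res a P) (c.map (hide a)) := by
  obtain ⟨A, X, P', hX, hA, hP, d, hd, rfl⟩ := h
  have hXP : L.WF (.par X P') := resList_wf.1 hP.wf.2
  obtain ⟨b, hb⟩ := Infinite.exists_notMem_finset
    (N ∪ A.toFinset ∪ X.fn ∪ (resList A (.par X P')).fn)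
  simp only [Finset.mem_union, List.mem_toFinset, not_or] at hb
  obtain ⟨⟨⟨hbN, hbA⟩, hbX⟩, hb⟩ := hb
  have haA : a ∉ A := fun h => hA a h (by simp)
  have hf := (Equiv.swap a b).injective
  have hmap : A.map (Equiv.swap a b) = A := by
    conv_rhs => rw [← List.map_id A]
    exact List.map_congr_left fun x hx =>
      Equiv.swap_apply_of_ne_of_ne (fun h => haA (h ▸ hx)) fun h => hbA (h ▸ hx)
  have hα := Alpha.convRes a b _ hb
  rw [resList_rename, hmap] at hα
  refine ⟨b :: A, X.rename (Equiv.swap a b), P'.rename (Equiv.swap a b), hX.rename _, ?_, ?_,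
    d.map (lift (Equiv.swap a b)), ?_, ?_⟩
  · intro x hx
    rcases List.mem_cons.1 hx with rfl | hx
    · exact hbN
    · exact fun h => hA x hx (by simp [h])
  · refine (hP.res a).trans (.ax (resList_wf.2 hXP) ?_ (.alpha hα))
    exact resList_wf.2 (hXP.rename hf)
  · rw [Proc.acts_rename hf]
    exact ⟨d, hd, rfl⟩
  · rw [Cap.map_map, Cap.map_map]
    refine Cap.map_congr fun x hx => ?_
    rw [hideAll_cons]
    cases x with
    | zero => simp [lift, hide, hideAll]
    | succ x =>
      have hxb : x ≠ b := fun h => hbX (h ▸ Proc.names_acts hd hx)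
      by_cases hxa : x = a
      · subst hxa
        simp [lift, hide, hideAll, hbA, haA]
      · simp only [lift, Equiv.swap_apply_of_ne_of_ne hxa hxb]
        by_cases hxA : x ∈ A <;> simp [hide, hideAll, hxA, hxa, hxb]

/-- The induction needs an arbitrary `N`, since each parallel neighbour and each restriction passed
on the way adds names to avoid. -/
theorem Lang.exposes_of_mem_acts (hP : L.WF P) (hc : c ∈ P.acts) (N : Finset Name) :
    L.Exposes N P c := by
  induction P generalizing c N with
  | nil => cases hc
  | ok => exact .of_isPrefix hP trivial hc
  | par P Q ihP ihQ =>
    rcases hc with hc | hc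
    · exact (ihP hP.1 hc _).par_left hP.2
    · exact .of_sc (SC.parComm hP.1 hP.2) ((ihQ hP.2 hc _).par_left hP.1)
  | res a P ih =>
    obtain ⟨c, hc, rfl⟩ := hc
    exact (ih hP hc _).res
  | ite s t P Q ihP ihQ =>
    rcases hc with ⟨h, hc⟩ | ⟨h, hc⟩
    · exact .of_sc (SC.iteEq h hP.1 hP.2) (ihP hP.1 hc _)
    · exact .of_sc (SC.iteNe h hP.1 hP.2) (ihQ hP.2 hc _)
  | rep P ih => exact .of_sc (SC.repUnfold hP) ((ih hP hc _).par_left hP)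
  | aout o => exact .of_isPrefix hP trivial hc
  | sout o P _ => exact .of_isPrefix hP trivial hc
  | inp I P _ => exact .of_isPrefix hP trivial hc

/-- A process has an active success process if and only if it is structurally equivalent to
one with a top-level success process. -/
theorem Lang.ok_mem_acts_iff (hP : L.WF P) : Cap.ok ∈ P.acts ↔ ∃ Q, SC L P (.par Q .ok) := by
  constructor
  · intro h
    obtain ⟨A, X, P', hX, -, h, d, hd, hc⟩ := Lang.exposes_of_mem_acts hP h ∅
    have hXP : L.WF (.par X P') := resList_wf.1 h.wf.2
    cases d <;> simp only [Cap.map, reduceCtorEq] at hc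
    have : X = .ok := by
      cases X <;> simp_all [Proc.IsPrefix, Proc.acts, Cap.map]
    subst this
    -- The success process has no free names, so scope extrusion read backwards frees it from all
    -- restrictions.
    have h₁ : SC L (.par .ok (resList A P')) (resList A (.par .ok P')) :=
      SC.extrude trivial hXP.2 (by simp [Proc.fn])
    exact ⟨_, (h.trans h₁.symm).trans (SC.parComm trivial (resList_wf.2 hXP.2))⟩
  · rintro ⟨Q, h⟩
    rw [h.acts_eq.1]
    exact .inr rfl

theorem Lang.succeeds_of_ok_mem_acts {P : L.Processes} (h : Cap.ok ∈ P.1.acts) :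
    Lang.Succeeds P := by
  obtain ⟨Q, h⟩ := (Lang.ok_mem_acts_iff P.2).1 h
  exact ⟨P, Q, .refl, h⟩

/-! ### Reductions in binary languages -/

theorem Red.of_polyMatch {o : Out} {i : Inp} {σ : Subst} {X Q : Proc} (hX : L.WF X)
    (hQ : L.WF (.inp [i] Q)) (ho : X = .aout o ∨ ∃ P, X = .sout o P) (hc : o.ch = i.ch)
    (hm : PolyMatch o.data i.pats σ) : ∃ R, Red L (.par X (.inp [i] Q)) R := by
  have hj : JoinMatch [o] [i] (σ ++ []) := .cons hc hm .nil
  rcases ho with rfl | ⟨P, rfl⟩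
  · exact ⟨_, .commA (os := [o]) ⟨hX, hQ⟩ hj⟩
  · exact ⟨_, .commS (os := [(o, P)]) ⟨hX, hQ⟩ hj⟩

/-- A match of the hidden capabilities never compares the anonymous `0`, so the original channels,
terms and patterns already match. In a binary language this one component is the whole input. -/
theorem Red.of_fits (hL : L.coord = .B) {X Y : Proc} (hX : L.WF X) (hY : L.WF Y)
    (hpX : X.IsPrefix) (hpY : Y.IsPrefix) {o : Out} {i : Inp} {A B : List Name}
    (hc : Cap.out o ∈ X.acts) (hd : Cap.inp i ∈ Y.acts)
    (h : React ((Cap.out o).map (hideAll A)) ((Cap.inp i).map (hideAll B))) :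
    ∃ R, Red L (.par X Y) R := by
  have hX' : ∃ o', (X = .aout o' ∨ ∃ P, X = .sout o' P) ∧
      Cap.out o = (Cap.out o').map Nat.succ := by
    cases X <;> simp_all [Proc.IsPrefix, Proc.acts, Cap.map]
  have hY' : ∃ i' Q, Y = .inp [i'] Q ∧ Cap.inp i = (Cap.inp i').map Nat.succ := by
    cases Y with
    | inp I Q =>
      have hI := hY.1
      rw [Lang.JoinOK, hL, List.length_eq_one_iff] at hI
      obtain ⟨i', rfl⟩ := hI
      obtain ⟨j, hj, h⟩ := hd
      rw [List.mem_singleton] at hj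
      exact ⟨i', Q, rfl, hj ▸ h⟩
    | _ => simp_all [Proc.IsPrefix, Proc.acts, Cap.map]
  obtain ⟨o', ho, hc'⟩ := hX'
  obtain ⟨i', Q, rfl, hd'⟩ := hY'
  rw [hc', hd', Cap.map_map, Cap.map_map] at h
  -- Shifting and then hiding is injective outside the preimage of `0`, even across the different
  -- lists `A` and `B`.
  obtain ⟨h₁, ⟨σ, h₂⟩, -⟩ := Fits.of_map (fun x y h h₀ => by
    have hx := fun hx => h₀ (if_pos hx)
    have hy := fun hy => h₀ (h.trans (if_pos hy))
    exact Nat.succ_injective ((if_neg hx).symm.trans (h.trans (if_neg hy)))) (show Fits _ _ from h)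
  exact Red.of_polyMatch hX hY ho h₁ h₂

/-- Exposing `X` under names fresh for `Q`, and then `Y` under names fresh for the process
containing `X`, lets both blocks of restrictions extrude, and `X` and `Y` become neighbours. -/
theorem Red.of_cross (hL : L.coord = .B) (hP : L.WF P) (hQ : L.WF Q)
    (h : Cross P.acts Q.acts) : ∃ R, Red L (.par P Q) R := by
  obtain ⟨c, hc, d, hd, h⟩ := h
  obtain ⟨A, X, P', hX, hA, hPX, c, hcX, rfl⟩ := L.exposes_of_mem_acts hP hc Q.fn
  have hXP : L.WF (.par X P') := resList_wf.1 hPX.wf.2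
  obtain ⟨B, Y, Q', hY, hB, hQY, d, hdY, rfl⟩ := L.exposes_of_mem_acts hQ hd (Proc.par X P').fn
  have hYQ : L.WF (.par Y Q') := resList_wf.1 hQY.wf.2
  have hsc : SC L (.par P Q)
      (Calc.resList A (Calc.resList B (.par (.par X Y) (.par P' Q')))) := by
    refine (hPX.par (.refl hQ)).trans ((SC.parComm (resList_wf.2 hXP) hQ).trans ?_)
    refine (SC.extrude hQ hXP hA).trans (SC.resList A ?_)
    refine (SC.parComm hQ hXP).trans (((SC.refl hXP).par hQY).trans ?_)
    refine (SC.extrude hXP hYQ hB).trans (SC.resList B ?_)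
    exact SC.parParComm hXP.1 hXP.2 hYQ.1 hYQ.2
  have hred : ∃ R, Red L (.par X Y) R := by
    cases c with
    | out o =>
      cases d with
      | inp i => exact Red.of_fits hL hXP.1 hYQ.1 hX hY hcX hdY h
      | _ => exact h.elim
    | inp i =>
      cases d with
      | out o =>
        obtain ⟨R, hR⟩ := Red.of_fits hL hYQ.1 hXP.1 hY hX hdY hcX h.symm
        exact ⟨R, .struct (SC.parComm hXP.1 hYQ.1) hR (.refl hR.wf.2)⟩
      | _ => exact h.elim
    | ok => exact h.elim
  obtain ⟨R, hR⟩ := hred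
  have hR' := ((hR.par (Q := Proc.par P' Q') (show L.WF (.par P' Q') from ⟨hXP.2, hYQ.2⟩)).resList B).resList A
  exact ⟨_, .struct hsc hR' (.refl hR'.wf.2)⟩

theorem Red.of_sc (h : SC L P Q) (hQ : ∃ R, Red L Q R) : ∃ R, Red L P R := by
  obtain ⟨R, hR⟩ := hQ
  exact ⟨R, .struct h hR (.refl hR.wf.2)⟩

/-- In a binary language, two matching active prefixes yield a reduction. -/
theorem Red.of_canReact (hL : L.coord = .B) (hP : L.WF P) (h : P.CanReact) :
    ∃ R, Red L P R := by
  induction P with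
  | par P Q ihP ihQ =>
    rcases h with h | h | h
    · obtain ⟨R, hR⟩ := ihP hP.1 h
      exact ⟨_, hR.par hP.2⟩
    · obtain ⟨R, hR⟩ := ihQ hP.2 h
      exact Red.of_sc (SC.parComm hP.1 hP.2) ⟨_, hR.par hP.1⟩
    · exact Red.of_cross hL hP.1 hP.2 h
  | res a P ih =>
    obtain ⟨R, hR⟩ := ih hP h
    exact ⟨_, hR.res a⟩
  | ite s t P Q ihP ihQ =>
    rcases h with ⟨h, h'⟩ | ⟨h, h'⟩
    · exact Red.of_sc (SC.iteEq h hP.1 hP.2) (ihP hP.1 h')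
    · exact Red.of_sc (SC.iteNe h hP.1 hP.2) (ihQ hP.2 h')
  | rep P ih =>
    have hP' : L.WF P := hP
    rcases h with h | h
    · obtain ⟨R, hR⟩ := ih hP h
      exact Red.of_sc (SC.repUnfold hP) ⟨_, hR.par (Q := .rep P) hP⟩
    · obtain ⟨R, hR⟩ := Red.of_cross hL hP' hP' h
      -- Two unfoldings supply the two copies that interact.
      refine Red.of_sc ((SC.repUnfold hP').trans (((SC.refl hP').par (SC.repUnfold hP')).trans
        (SC.parAssoc (R := .rep P) hP' hP' hP'))) ⟨_, hR.par (Q := .rep P) hP⟩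
  | _ => exact h.elim

theorem Lang.reduces_iff_canReact (hL : L.coord = .B) (P : L.Processes) :
    Lang.Reduces P ↔ P.1.CanReact :=
  (Lang.reduces_iff P).trans ⟨fun ⟨_, h⟩ => h.canReact hL, fun h => Red.of_canReact hL P.2 h⟩

/-! ### Contexts -/

theorem Ctx.alpha_fill {k : ℕ} {T T' : Fin k → Proc} (h : ∀ i, Alpha (T i) (T' i)) (C : Ctx k) :
    Alpha (C.fill T) (C.fill T') := by
  induction C with
  | hole i => exact h i
  | nil => exact .refl _
  | ok => exact .refl _
  | par C D hC hD => exact hC.par hD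
  | res a C hC => exact hC.res a
  | ite s t C D hC hD => exact hC.ite s t hD
  | rep C hC => exact hC.rep
  | aout o => exact .refl _
  | sout o C hC => exact hC.sout o
  | inp I C hC => exact hC.inp I

/-- Every capability of `F T` stems from at most one of the components of `T`, and every
interaction from at most two of them. -/
structure IsBinary {n : ℕ} (F : (Fin n → Proc) → Proc) : Prop where
  acts : ∀ T, ∀ c ∈ (F T).acts, ∃ j, ∀ T', T' j = T j → c ∈ (F T').acts
  canReact : ∀ T, (F T).CanReact →
    ∃ j₁ j₂, ∀ T', T' j₁ = T j₁ → T' j₂ = T j₂ → (F T').CanReact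

theorem IsBinary.proj {n : ℕ} (i : Fin n) : IsBinary fun T => T i where
  acts _ _ hc := ⟨i, fun _ h => h ▸ hc⟩
  canReact _ hT := ⟨i, i, fun _ h _ => h ▸ hT⟩

theorem IsBinary.cross {n : ℕ} {F G : (Fin n → Proc) → Proc} (hF : IsBinary F)
    (hG : IsBinary G) {T : Fin n → Proc} (h : Cross (F T).acts (G T).acts) :
    ∃ j₁ j₂, ∀ T', T' j₁ = T j₁ → T' j₂ = T j₂ → Cross (F T').acts (G T').acts := by
  obtain ⟨c, hc, d, hd, h⟩ := h
  obtain ⟨j₁, h₁⟩ := hF.acts T c hc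
  obtain ⟨j₂, h₂⟩ := hG.acts T d hd
  exact ⟨j₁, j₂, fun T' e₁ e₂ => ⟨c, h₁ T' e₁, d, h₂ T' e₂, h⟩⟩

/-- A capability belongs either to the context itself or to one hole, and an interaction combines
two capabilities. The holes receive functions of `T`, so that contexts can be nested; `NeZero n`
provides an arbitrary index for what the context contributes itself. Repeated holes do no harm. -/
theorem IsBinary.fill {n k : ℕ} [NeZero n] {F : Fin k → (Fin n → Proc) → Proc}
    (hF : ∀ i, IsBinary (F i)) (C : Ctx k) : IsBinary fun T => C.fill fun i => F i T := by
  have const : ∀ P : Proc, ¬ P.CanReact → IsBinary fun _ : Fin n → Proc => P := fun P h =>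
    ⟨fun _ _ hc => ⟨0, fun _ _ => hc⟩, fun _ h' => (h h').elim⟩
  induction C with
  | hole i => exact hF i
  | nil => exact const .nil id
  | ok => exact const .ok id
  | par C D hC hD =>
    refine ⟨fun T c hc => ?_, fun T h => ?_⟩
    · rcases hc with hc | hc
      · obtain ⟨j, h⟩ := hC.acts T c hc
        exact ⟨j, fun T' e => .inl (h T' e)⟩
      · obtain ⟨j, h⟩ := hD.acts T c hc
        exact ⟨j, fun T' e => .inr (h T' e)⟩
    · rcases h with h | h | h
      · obtain ⟨j₁, j₂, h⟩ := hC.canReact T h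
        exact ⟨j₁, j₂, fun T' e₁ e₂ => .inl (h T' e₁ e₂)⟩
      · obtain ⟨j₁, j₂, h⟩ := hD.canReact T h
        exact ⟨j₁, j₂, fun T' e₁ e₂ => .inr (.inl (h T' e₁ e₂))⟩
      · obtain ⟨j₁, j₂, h⟩ := hC.cross hD h
        exact ⟨j₁, j₂, fun T' e₁ e₂ => .inr (.inr (h T' e₁ e₂))⟩
  | res a C hC =>
    refine ⟨?_, hC.canReact⟩
    rintro T _ ⟨c, hc, rfl⟩
    obtain ⟨j, h⟩ := hC.acts T c hc
    exact ⟨j, fun T' e => ⟨c, h T' e, rfl⟩⟩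
  | ite s t C D hC hD =>
    refine ⟨fun T c hc => ?_, fun T h => ?_⟩
    · rcases hc with ⟨hs, hc⟩ | ⟨hs, hc⟩
      · obtain ⟨j, h⟩ := hC.acts T c hc
        exact ⟨j, fun T' e => .inl ⟨hs, h T' e⟩⟩
      · obtain ⟨j, h⟩ := hD.acts T c hc
        exact ⟨j, fun T' e => .inr ⟨hs, h T' e⟩⟩
    · rcases h with ⟨hs, h⟩ | ⟨hs, h⟩
      · obtain ⟨j₁, j₂, h⟩ := hC.canReact T h
        exact ⟨j₁, j₂, fun T' e₁ e₂ => .inl ⟨hs, h T' e₁ e₂⟩⟩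
      · obtain ⟨j₁, j₂, h⟩ := hD.canReact T h
        exact ⟨j₁, j₂, fun T' e₁ e₂ => .inr ⟨hs, h T' e₁ e₂⟩⟩
  | rep C hC =>
    refine ⟨hC.acts, fun T h => ?_⟩
    rcases h with h | h
    · obtain ⟨j₁, j₂, h⟩ := hC.canReact T h
      exact ⟨j₁, j₂, fun T' e₁ e₂ => .inl (h T' e₁ e₂)⟩
    · obtain ⟨j₁, j₂, h⟩ := hC.cross hC h
      exact ⟨j₁, j₂, fun T' e₁ e₂ => .inr (h T' e₁ e₂)⟩
  | aout o => exact const (.aout o) id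
  -- Holes under a prefix are inactive, so their fillings contribute nothing.
  | sout o C => exact ⟨fun _ _ hc => ⟨0, fun _ _ => hc⟩, fun _ h => h.elim⟩
  | inp I C => exact ⟨fun _ _ hc => ⟨0, fun _ _ => hc⟩, fun _ h => h.elim⟩

/-! ### Joins -/

/-- An output of the name `0`, on the channel `0` if there are channels. -/
def Lang.unitOut (L : Lang) : Out :=
  ⟨match L.medium with
    | .D => none
    | .C => some (.name 0), [.name 0]⟩

/-- The unit output as a process. -/
def Lang.unitOutProc (L : Lang) : Proc :=
  match L.sync with
  | .A => .aout L.unitOut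
  | .S => .sout L.unitOut .nil

/-- An input component that accepts the unit output. -/
def Lang.unitInp (L : Lang) (x : Name) : Inp := ⟨L.unitOut.ch, [.bind x]⟩

/-- An inert process in which the name `0` is free. -/
def inert : Proc := .ite (.name 0) (.name 0) .nil .nil

/-- A join of `k` inputs that accepts `k` unit outputs and then succeeds. -/
def Lang.unitJoin (L : Lang) (k : ℕ) : Proc :=
  -- The binding names start at `1`, so that `0` is not captured. The inert part of the continuation
  -- keeps `0` free even in dataspace-based languages, where the inputs have no channel.
  .inp ((List.range k).map fun n => L.unitInp (n + 1)) (.par inert .ok)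

theorem Lang.unitOut_ok (L : Lang) : L.OutOK L.unitOut := by
  refine ⟨?_, ?_, ?_⟩
  · unfold Lang.ChOK Lang.unitOut
    cases h : L.medium
    · simp
    · simp [L.termOK_name]
  · unfold Lang.LenOK Lang.unitOut
    split <;> simp
  · simp [Lang.unitOut, L.termOK_name]

theorem Lang.unitOutProc_wf (L : Lang) : L.WF L.unitOutProc := by
  unfold Lang.unitOutProc
  split
  · exact ⟨by assumption, L.unitOut_ok⟩
  · exact ⟨by assumption, L.unitOut_ok, trivial⟩

theorem Lang.inert_wf (L : Lang) : L.WF inert := ⟨trivial, trivial⟩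

theorem Lang.inpBinders_unitInp (L : Lang) (l : List ℕ) :
    inpBinders (l.map fun n => L.unitInp (n + 1)) = l.map (· + 1) := by
  induction l with
  | nil => rfl
  | cons n l ih =>
    simp only [inpBinders, List.flatMap_cons, List.map_cons] at *
    rw [ih]
    rfl

theorem Lang.unitJoin_wf (L : Lang) {k : ℕ} (hk : L.JoinOK k) : L.WF (L.unitJoin k) := by
  refine ⟨by simpa using hk, ?_, ?_, L.inert_wf, trivial⟩
  · intro i hi
    obtain ⟨n, -, rfl⟩ := List.mem_map.1 hi
    refine ⟨L.unitOut_ok.1, L.unitOut_ok.2.1, ?_⟩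
    simp only [Lang.unitInp, List.mem_singleton, forall_eq]
    unfold Lang.PatOK
    split <;> simp
  · rw [L.inpBinders_unitInp]
    exact List.nodup_range.map fun _ _ => Nat.succ_injective.eq_iff.1

theorem Lang.joinMatch_unit (L : Lang) (l : List ℕ) :
    ∃ σ, JoinMatch (l.map fun _ => L.unitOut) (l.map fun n => L.unitInp (n + 1)) σ := by
  induction l with
  | nil => exact ⟨_, .nil⟩
  | cons n l ih =>
    obtain ⟨σ, ih⟩ := ih
    exact ⟨_, .cons rfl (.cons (.bind _ _) .nil) ih⟩

/-- The unit outputs and the join react and yield a successful process. -/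
theorem Lang.red_unitJoin (L : Lang) {k : ℕ} (hk : L.JoinOK k) :
    ∃ R, Red L (parList (List.replicate k L.unitOutProc) (L.unitJoin k)) R ∧
      Cap.ok ∈ R.acts := by
  obtain ⟨σ, hσ⟩ := L.joinMatch_unit (List.range k)
  have hwf : L.WF (parList (List.replicate k L.unitOutProc) (L.unitJoin k)) :=
    parList_wf.2 ⟨fun P hP => List.eq_of_mem_replicate hP ▸ L.unitOutProc_wf, L.unitJoin_wf hk⟩
  have hok : Cap.ok ∈ ((Proc.par inert .ok).subst σ.fn).acts := .inr rfl
  cases hs : L.sync with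
  | A =>
    have h₁ : List.replicate k L.unitOutProc =
        ((List.range k).map fun _ => L.unitOut).map .aout := by
      simp [Lang.unitOutProc, hs, List.map_const']
    rw [h₁] at hwf ⊢
    exact ⟨_, .commA hwf hσ, hok⟩
  | S =>
    have h₁ : List.replicate k L.unitOutProc =
        ((List.range k).map fun _ => (L.unitOut, Proc.nil)).map fun o => .sout o.1 o.2 := by
      simp [Lang.unitOutProc, hs, List.map_const']
    rw [h₁] at hwf ⊢
    refine ⟨_, .commS hwf (by simpa [Function.comp_def] using hσ), ?_⟩
    generalize List.map Prod.snd _ = l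
    induction l with
    | nil => exact hok
    | cons P l ih => exact .inr ih

theorem Lang.nOut_unitOutProc (L : Lang) : L.unitOutProc.nOut = 1 := by
  unfold Lang.unitOutProc
  split <;> rfl

theorem Lang.minJoin_unitOutProc (L : Lang) : L.unitOutProc.minJoin = ⊤ := by
  unfold Lang.unitOutProc
  split <;> rfl

theorem nOut_inert : inert.nOut = 0 := by simp [inert, Proc.nOut]

theorem minJoin_inert : inert.minJoin = ⊤ := by simp [inert, Proc.minJoin]

theorem Lang.nOut_unitJoin (L : Lang) (k : ℕ) : (L.unitJoin k).nOut = 0 := rfl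

theorem Lang.minJoin_unitJoin (L : Lang) (k : ℕ) : (L.unitJoin k).minJoin = k := by
  simp [Lang.unitJoin, Proc.minJoin]

/-! ### The coordination degree -/

theorem Lang.parAll_ofFn {n : ℕ} (S : Fin n → L.Processes) :
    (L.parAll (List.ofFn S)).1 = parList (List.ofFn fun i => (S i).1) .nil := by
  induction n with
  | zero => rfl
  | succ n ih =>
    rw [List.ofFn_succ, List.ofFn_succ]
    exact congrArg (Proc.par (S 0).1) (ih _)

theorem Lang.nOut_parAll {n : ℕ} (S : Fin n → L.Processes) :
    (L.parAll (List.ofFn S)).1.nOut = ∑ i, (S i).1.nOut := by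
  rw [Lang.parAll_ofFn, nOut_parList, List.map_ofFn, List.sum_ofFn]
  simp [Proc.nOut]

theorem Lang.le_minJoin_parAll {m : ℕ∞} {l : List L.Processes} (h : ∀ P ∈ l, m ≤ P.1.minJoin) :
    m ≤ (L.parAll l).1.minJoin := by
  induction l with
  | nil => exact le_top
  | cons P l ih => exact le_inf (h P (by simp)) (ih fun P hP => h P (by simp [hP]))

theorem Lang.not_reduces_of_nOut_lt {P : L.Processes} (h : P.1.nOut < P.1.minJoin) :
    ¬ Lang.Reduces P := fun ⟨_, hQ⟩ => hQ.minJoin_le_nOut.not_gt h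

/-- The join and the unit outputs must coordinate. -/
theorem Lang.mustCoordinate_unit {k : ℕ} (hk : L.JoinOK k) :
    L.MustCoordinate (Fin.cons ⟨L.unitJoin k, L.unitJoin_wf hk⟩
      fun _ : Fin k => ⟨L.unitOutProc, L.unitOutProc_wf⟩ : Fin (k + 1) → L.Processes) := by
  set J : L.Processes := ⟨L.unitJoin k, L.unitJoin_wf hk⟩ with hJ
  set O : L.Processes := ⟨L.unitOutProc, L.unitOutProc_wf⟩ with hO
  set S : Fin (k + 1) → L.Processes := Fin.cons J fun _ : Fin k => O with hS
  have hnil : L.nilP.1.nOut = 0 ∧ L.nilP.1.minJoin = ⊤ := ⟨rfl, rfl⟩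
  constructor
  · obtain ⟨R, hR, -⟩ := L.red_unitJoin hk
    refine (Lang.reduces_iff _).2 (Red.of_sc ?_ ⟨R, hR⟩)
    have h₁ : (L.parAll (List.ofFn S)).1 =
        .par (L.unitJoin k) (parList (List.replicate k L.unitOutProc) .nil) := by
      rw [Lang.parAll_ofFn, List.ofFn_succ]
      have : (List.ofFn fun i : Fin k => (S i.succ).1) = List.replicate k L.unitOutProc :=
        List.ofFn_const k _
      rw [this]
      rfl
    rw [h₁]
    have hO' : ∀ P ∈ List.replicate k L.unitOutProc, L.WF P :=
      fun P hP => List.eq_of_mem_replicate hP ▸ L.unitOutProc_wf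
    exact (SC.par_parList (Q := .nil) hO' (L.unitJoin_wf hk) trivial).trans
      (SC.parList hO' (SC.parNil (L.unitJoin_wf hk)))
  · intro j
    apply Lang.not_reduces_of_nOut_lt
    rw [Lang.nOut_parAll]
    have h₀ : (S 0).1.nOut = 0 ∧ (S 0).1.minJoin = k :=
      ⟨L.nOut_unitJoin k, L.minJoin_unitJoin k⟩
    have h₁ : ∀ i : Fin k, (S i.succ).1.nOut = 1 ∧ (S i.succ).1.minJoin = ⊤ :=
      fun _ => ⟨L.nOut_unitOutProc, L.minJoin_unitOutProc⟩
    -- Exactly the outputs other than the deleted component count, so their number is `k` if the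
    -- join at index `0` was deleted and `k - 1` otherwise.
    have hn : ∀ i, (Function.update S j L.nilP i).1.nOut =
        if i ∈ (Finset.univ.erase 0).erase j then 1 else 0 := by
      intro i
      by_cases hij : i = j
      · subst hij
        simp [hnil.1]
      · rw [Function.update_of_ne hij]
        obtain rfl | ⟨i, rfl⟩ := i.eq_zero_or_eq_succ
        · simp [h₀.1]
        · simp [(h₁ i).1, hij]
    rw [Finset.sum_congr rfl fun i _ => hn i, Finset.sum_ite_mem, Finset.univ_inter,
      Finset.sum_const, nsmul_one]
    by_cases hj : j = 0
    · subst hj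
      refine lt_of_lt_of_le (ENat.natCast_lt_top _) (Lang.le_minJoin_parAll fun P hP => ?_)
      obtain ⟨i, rfl⟩ := List.mem_ofFn.1 hP
      obtain rfl | ⟨i, rfl⟩ := i.eq_zero_or_eq_succ
      · simp [hnil.2]
      · rw [Function.update_of_ne i.succ_ne_zero, (h₁ i).2]
    · have hk₀ : k ≠ 0 := by
        rintro rfl
        exact hj (Subsingleton.elim (α := Fin 1) j 0)
      rw [Finset.card_erase_of_mem (by simp [hj]), Finset.card_erase_of_mem (by simp),
        Finset.card_univ, Fintype.card_fin]
      refine lt_of_lt_of_le (b := (k : ℕ∞)) (by exact_mod_cast (by omega : k + 1 - 1 - 1 < k))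
        (Lang.le_minJoin_parAll fun P hP => ?_)
      obtain ⟨i, rfl⟩ := List.mem_ofFn.1 hP
      by_cases hij : i = j
      · subst hij
        simp [hnil.2]
      · rw [Function.update_of_ne hij]
        obtain rfl | ⟨i, rfl⟩ := i.eq_zero_or_eq_succ
        · rw [h₀.2]
        · simp [(h₁ i).2]

/-- In a binary language, at most two processes must coordinate. -/
theorem Lang.MustCoordinate.le_two (hL : L.coord = .B) {n : ℕ} {S : Fin n → L.Processes}
    (h : L.MustCoordinate S) : n ≤ 2 := by
  by_contra! hn
  have : NeZero n := ⟨by omega⟩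
  -- The parallel composition is the filling of a context with one hole per component.
  have key : ∀ l : List (Fin n), IsBinary fun T : Fin n → Proc => parList (l.map T) .nil := by
    intro l
    let C : Ctx n := l.foldr (fun i C => .par (.hole i) C) .nil
    have hC : ∀ T, C.fill T = parList (l.map T) .nil := by
      intro T
      simp only [C]
      induction l with
      | nil => rfl
      | cons i l ih => exact congrArg (Proc.par (T i)) ih
    have := IsBinary.fill (F := fun i T => T i) IsBinary.proj C
    simpa only [hC] using this
  have hval : ∀ S : Fin n → L.Processes, (L.parAll (List.ofFn S)).1 =
      parList ((List.finRange n).map fun i => (S i).1) .nil := by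
    intro S
    rw [Lang.parAll_ofFn, List.ofFn_eq_map]
  have hr := (Lang.reduces_iff_canReact hL _).1 h.1
  rw [hval] at hr
  obtain ⟨j₁, j₂, hj⟩ := (key _).canReact _ hr
  -- With more than two components, some component is not among the two responsible for the
  -- reduction and can be deleted.
  obtain ⟨j, hj'⟩ : ∃ j, j ∉ ({j₁, j₂} : Finset (Fin n)) := by
    by_contra! hall
    have := Finset.card_le_card (fun j _ => hall j : Finset.univ ⊆ ({j₁, j₂} : Finset (Fin n)))
    have := (Finset.card_le_two (a := j₁) (b := j₂))
    simp only [Finset.card_univ, Fintype.card_fin] at *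
    omega
  simp only [Finset.mem_insert, Finset.mem_singleton, not_or] at hj'
  refine h.2 j ((Lang.reduces_iff_canReact hL _).2 ?_)
  rw [hval]
  refine hj (fun i => (Function.update S j L.nilP i).1) ?_ ?_
  · rw [Function.update_of_ne (Ne.symm hj'.1)]
  · rw [Function.update_of_ne (Ne.symm hj'.2)]

theorem Lang.coordDegree_joining (hL : L.coord = .J) : L.coordDegree = ⊤ := by
  refine ENat.eq_top_iff_forall_ge.2 fun n => ?_
  have hk : L.JoinOK (n + 1) := by simp [Lang.JoinOK, hL]
  refine le_trans ?_ (le_sSup ⟨n + 1 + 1, _, rfl, Lang.mustCoordinate_unit hk⟩)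
  exact_mod_cast (by omega : n ≤ n + 1 + 1)

theorem Lang.coordDegree_binary (hL : L.coord = .B) : L.coordDegree = 2 := by
  have hk : L.JoinOK 1 := by simp [Lang.JoinOK, hL]
  refine le_antisymm (sSup_le ?_) (le_sSup ⟨1 + 1, _, rfl, Lang.mustCoordinate_unit hk⟩)
  rintro _ ⟨n, S, rfl, h⟩
  exact_mod_cast h.le_two hL

/-! ### Separation -/

theorem Lang.diverges_of_invariant {p : L.Processes → Prop}
    (hp : ∀ P, p P → ∃ Q, p Q ∧ Lang.Step P Q) {P : L.Processes} (h : p P) : Lang.Diverges P := by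
  have : Nonempty L.Processes := ⟨P⟩
  choose! f hf using hp
  have hi : ∀ n, p (f^[n] P) := fun n => by
    induction n with
    | zero => exact h
    | succ n ih =>
      rw [Function.iterate_succ_apply']
      exact (hf _ ih).1
  refine ⟨fun n => f^[n] P, rfl, fun n => ?_⟩
  simp only [Function.iterate_succ_apply']
  exact (hf _ (hi n)).2

theorem Lang.eq_of_steps_of_not_reduces {P Q : L.Processes} (hP : ¬ Lang.Reduces P)
    (h : Lang.Steps P Q) : Q = P := by
  rcases Relation.ReflTransGen.cases_head h with rfl | ⟨R, hR, -⟩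
  · rfl
  · exact (hP ⟨R, hR⟩).elim

/-- A valid encoding does not add reductions to stuck processes. -/
theorem Encoding.Valid.not_reduces {L₁ L₂ : Lang} {R : L₂.Processes → L₂.Processes → Prop}
    (hR : IsReference L₂ R) {e : Encoding L₁ L₂} (he : e.Valid R) {S : L₁.Processes}
    (hS : ¬ Lang.Reduces S) : ¬ Lang.Reduces (e.tr S) := by
  intro hr
  have hd : Lang.Diverges (e.tr S) := by
    -- The invariant is being reachable from the translation. As `S` is its own only derivative,
    -- every reachable `T` leads to some `T'` equivalent to the translation of `S`. So `T'` reduces,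
    -- and `T` has a next step towards `T'` or from it.
    refine Lang.diverges_of_invariant (p := fun T => Lang.Steps (e.tr S) T) ?_ .refl
    intro T hT
    obtain ⟨S', T', hS', hT', hRT⟩ := he.operational.2 S T hT
    obtain rfl := Lang.eq_of_steps_of_not_reduces hS hS'
    obtain ⟨U, hU⟩ := hR.reduction_sensitive _ _ hRT hr
    rcases Relation.ReflTransGen.cases_head hT' with rfl | ⟨V, hV, -⟩
    · exact ⟨U, hT.tail hU, hU⟩
    · exact ⟨V, hT.tail hV, hV⟩
  obtain ⟨f, h₀, hf⟩ := he.divergence S hd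
  exact hS ⟨f 1, h₀ ▸ hf 0⟩

/-- There is no valid encoding of a joining language into a binary one. -/
theorem Encoding.not_valid {L₁ L₂ : Lang} (h₁ : L₁.coord = .J) (h₂ : L₂.coord = .B)
    {R : L₂.Processes → L₂.Processes → Prop} (hR : IsReference L₂ R) (e : Encoding L₁ L₂) :
    ¬ e.Valid R := by
  intro he
  have hk : L₁.JoinOK 2 := by simp [Lang.JoinOK, h₁]
  let O : L₁.Processes := ⟨L₁.unitOutProc, L₁.unitOutProc_wf⟩
  let J : L₁.Processes := ⟨L₁.unitJoin 2, L₁.unitJoin_wf hk⟩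
  let Z : L₁.Processes := ⟨inert, L₁.inert_wf⟩
  let pr (P Q : L₁.Processes) : L₁.Processes := ⟨.par P.1 Q.1, P.2, Q.2⟩
  let S (T : Fin 3 → L₁.Processes) : L₁.Processes := pr (T 0) (pr (T 1) (T 2))
  have hfO : O.1.fn = {0} := by
    simp only [O, Lang.unitOutProc]
    split <;> simp only [Proc.fn, Lang.unitOut] <;> split <;> rfl
  have hfJ : J.1.fn = {0} := by
    simp only [J, Lang.unitJoin, Lang.unitInp, Lang.unitOut]
    split <;> rfl
  have hfZ : Z.1.fn = {0} := rfl
  -- The context may depend on the set of free names, so all processes are composed with free names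
  -- exactly `{0}` and the same `C` serves throughout.
  obtain ⟨C, hpar⟩ : ∃ C : Ctx 2, ∀ P Q : L₁.Processes, P.1.fn = {0} → Q.1.fn = {0} →
      Alpha (e.tr (pr P Q)).1 (C.fill ![(e.tr P).1, (e.tr Q).1]) := by
    obtain ⟨C, -, hC⟩ := he.compositional .par ⟨trivial, trivial⟩ {0}
    refine ⟨C, fun P Q hP hQ => ?_⟩
    have h := hC (show Fin 2 → L₁.Processes from ![P, Q]) (by
      change Finset.univ.biUnion (fun i : Fin 2 => (![P, Q] i).1.fn) = {0}
      simp [Finset.univ_fin2, Finset.biUnion_insert, hP, hQ])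
    have hv : (fun i : Fin 2 => (e.tr (![P, Q] i)).1) = ![(e.tr P).1, (e.tr Q).1] := by
      funext i
      match i with
      | 0 => rfl
      | 1 => rfl
    rw [← hv]
    exact h
  let F (T : Fin 3 → Proc) : Proc := C.fill ![T 0, C.fill ![T 1, T 2]]
  have hF : IsBinary F := by
    have h₁ := IsBinary.fill (n := 3) (F := fun (i : Fin 2) T => ![T 1, T 2] i) (fun i => by
      match i with
      | 0 => exact .proj 1
      | 1 => exact .proj 2) C
    exact IsBinary.fill (n := 3) (F := fun (i : Fin 2) T => ![T 0, C.fill ![T 1, T 2]] i)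
      (fun i => by
        match i with
        | 0 => exact .proj 0
        | 1 => exact h₁) C
  have hSF : ∀ T : Fin 3 → L₁.Processes, (∀ i, (T i).1.fn = {0}) →
      Alpha (e.tr (S T)).1 (F fun i => (e.tr (T i)).1) := by
    intro T hT
    refine (hpar _ _ (hT 0) (by simp [pr, Proc.fn, hT])).trans (Ctx.alpha_fill ?_ C)
    intro i
    match i with
    | 0 => exact .refl _
    | 1 => exact hpar _ _ (hT 1) (hT 2)
  let T₀ : Fin 3 → L₁.Processes := ![O, O, J]
  have hT₀ : ∀ i, (T₀ i).1.fn = {0} := by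
    intro i
    fin_cases i
    exacts [hfO, hfO, hfJ]
  -- replacing one component by the inert process yields a stuck process
  have hstuck : ∀ j, ¬ Lang.Reduces (S (Function.update T₀ j Z)) ∧
      Cap.ok ∉ (S (Function.update T₀ j Z)).1.acts := by
    have hO : O.1.nOut = 1 ∧ O.1.minJoin = ⊤ := ⟨L₁.nOut_unitOutProc, L₁.minJoin_unitOutProc⟩
    have hJ : J.1.nOut = 0 ∧ J.1.minJoin = 2 := ⟨L₁.nOut_unitJoin 2, L₁.minJoin_unitJoin 2⟩
    have hZ : Z.1.nOut = 0 ∧ Z.1.minJoin = ⊤ := ⟨nOut_inert, minJoin_inert⟩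
    have hO' : Cap.ok ∉ O.1.acts := by
      simp only [O, Lang.unitOutProc]
      split <;> simp [Proc.acts, Cap.map]
    have hJ' : Cap.ok ∉ J.1.acts := by simp [J, Lang.unitJoin, Proc.acts, Cap.map]
    have hZ' : Cap.ok ∉ Z.1.acts := by simp [Z, inert, Proc.acts]
    intro j
    constructor
    -- Without one output, a single output faces a join of two inputs; without the join, there is
    -- none.
    · apply Lang.not_reduces_of_nOut_lt
      fin_cases j <;>
        simp [S, pr, T₀, Function.update, Proc.nOut, Proc.minJoin, hO, hJ, hZ]
    · fin_cases j <;> simp [S, pr, T₀, Function.update, Proc.acts, hO', hJ', hZ']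
  have hsucc : Lang.Succeeds (S T₀) := by
    obtain ⟨Q, hQ, hok⟩ := L₁.red_unitJoin hk
    obtain ⟨P', hP'⟩ := (Lang.ok_mem_acts_iff hQ.wf.2).1 hok
    exact ⟨⟨Q, hQ.wf.2⟩, P', .single hQ, hP'⟩
  have hex : ∀ j₁ j₂ : Fin 3, ∃ j, j₁ ≠ j ∧ j₂ ≠ j := by decide
  have hupd : ∀ j, ∀ i, (Function.update T₀ j Z i).1.fn = {0} := by
    intro j i
    by_cases h : i = j
    · subst h; simp [hfZ]
    · rw [Function.update_of_ne h]; exact hT₀ i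
  obtain ⟨T, P'', hT, hok⟩ := (he.success _).1 hsucc
  have hα := (hSF T₀ hT₀).acts_eq
  -- Success of the translation is either immediate, hence due to one component, or preceded by a
  -- first reduction, due to at most two. The index `j` is chosen outside of these.
  rcases Relation.ReflTransGen.cases_head hT with rfl | ⟨U, hU, -⟩
  · have h : Cap.ok ∈ (e.tr (S T₀)).1.acts := (Lang.ok_mem_acts_iff (e.tr (S T₀)).2).2 ⟨_, hok⟩
    rw [hα.1] at h
    obtain ⟨i, hi⟩ := hF.acts (fun i => (e.tr (T₀ i)).1) _ h
    obtain ⟨j, hj, -⟩ := hex i i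
    have h' := hi (fun i => (e.tr (Function.update T₀ j Z i)).1)
      (by rw [Function.update_of_ne hj])
    rw [← (hSF _ (hupd j)).acts_eq.1] at h'
    obtain ⟨Q, P', hQ, hP'⟩ := (he.success _).2 (Lang.succeeds_of_ok_mem_acts h')
    obtain rfl := Lang.eq_of_steps_of_not_reduces (hstuck j).1 hQ
    exact (hstuck j).2 ((Lang.ok_mem_acts_iff (Subtype.prop _)).2 ⟨_, hP'⟩)
  · have h : (e.tr (S T₀)).1.CanReact := (Lang.reduces_iff_canReact h₂ _).1 ⟨U, hU⟩
    rw [hα.2] at h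
    obtain ⟨j₁, j₂, hi⟩ := hF.canReact (fun i => (e.tr (T₀ i)).1) h
    obtain ⟨j, hj₁, hj₂⟩ := hex j₁ j₂
    have h' := hi (fun i => (e.tr (Function.update T₀ j Z i)).1)
      (by rw [Function.update_of_ne hj₁]) (by rw [Function.update_of_ne hj₂])
    rw [← (hSF _ (hupd j)).acts_eq.2] at h'
    exact he.not_reduces hR (hstuck j).1 ((Lang.reduces_iff_canReact h₂ _).2 h')

/-! ### Binary languages inside joining languages -/

/-- All inputs of the process are binary. -/
def Proc.AllBinary : Proc → Prop
  | .par P Q => P.AllBinary ∧ Q.AllBinary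
  | .res _ P => P.AllBinary
  | .ite _ _ P Q => P.AllBinary ∧ Q.AllBinary
  | .rep P => P.AllBinary
  | .sout _ P => P.AllBinary
  | .inp I P => I.length = 1 ∧ P.AllBinary
  | _ => True

/-- All inputs of the process are binary, except in the discarded branches of those
conditionals that are not under an input. -/
def Proc.LiveBinary : Proc → Prop
  | .par P Q => P.LiveBinary ∧ Q.LiveBinary
  | .res _ P => P.LiveBinary
  | .ite s t P Q => (s = t → P.LiveBinary) ∧ (s ≠ t → Q.LiveBinary)
  | .rep P => P.LiveBinary
  | .sout _ P => P.LiveBinary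
  | .inp I P => I.length = 1 ∧ P.AllBinary
  | _ => True

/-- Replace all inputs that are not binary by the null process. -/
def Proc.binarize : Proc → Proc
  | .nil => .nil
  | .ok => .ok
  | .par P Q => .par P.binarize Q.binarize
  | .res a P => .res a P.binarize
  | .ite s t P Q => .ite s t P.binarize Q.binarize
  | .rep P => .rep P.binarize
  | .aout o => .aout o
  | .sout o P => .sout o P.binarize
  | .inp I P => if I.length = 1 then .inp I P.binarize else .nil

theorem Proc.AllBinary.liveBinary {P : Proc} (h : P.AllBinary) : P.LiveBinary := by
  induction P with
  | par P Q hP hQ => exact ⟨hP h.1, hQ h.2⟩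
  | res a P hP => exact hP h
  | ite s t P Q hP hQ => exact ⟨fun _ => hP h.1, fun _ => hQ h.2⟩
  | rep P hP => exact hP h
  | sout o P hP => exact hP h
  | inp I P hP => exact h
  | _ => trivial

theorem Proc.AllBinary.binarize_eq {P : Proc} (h : P.AllBinary) : P.binarize = P := by
  induction P with
  | inp I P hP => simp [Proc.binarize, h.1, hP h.2]
  | _ => simp_all [Proc.AllBinary, Proc.binarize]

/-- `LiveBinary` lacks this property, because a substitution can make a discarded branch live. Hence
the stronger condition on continuations of inputs. -/
theorem Proc.AllBinary.subst {P : Proc} (h : P.AllBinary) (σ : Name → Term) :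
    (P.subst σ).AllBinary := by
  induction P generalizing σ with
  | par P Q hP hQ => exact ⟨hP h.1 σ, hQ h.2 σ⟩
  | res a P hP => exact hP h _
  | ite s t P Q hP hQ => exact ⟨hP h.1 σ, hQ h.2 σ⟩
  | rep P hP => exact hP h σ
  | sout o P hP => exact hP h σ
  | inp I P hP => exact ⟨by simpa using h.1, hP h.2 _⟩
  | _ => trivial

theorem Proc.allBinary_rename (f : Name → Name) (P : Proc) :
    (P.rename f).AllBinary ↔ P.AllBinary := by
  induction P <;> simp_all [Proc.rename, Proc.AllBinary]

theorem Proc.liveBinary_rename {f : Name → Name} (hf : Function.Injective f) (P : Proc) :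
    (P.rename f).LiveBinary ↔ P.LiveBinary := by
  induction P with
  | ite s t P Q hP hQ =>
    simp only [Proc.rename, Proc.LiveBinary, hP, hQ, ne_eq, Term.subst_name_eq_iff hf s t]
  | inp I P hP => simp [Proc.rename, Proc.LiveBinary, Proc.allBinary_rename]
  | _ => simp_all [Proc.rename, Proc.LiveBinary]

theorem Proc.binarize_rename (f : Name → Name) (P : Proc) :
    (P.rename f).binarize = P.binarize.rename f := by
  induction P with
  | inp I P hP =>
    by_cases h : I.length = 1 <;> simp [Proc.rename, Proc.binarize, h, hP]
  | _ => simp_all [Proc.rename, Proc.binarize]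

/-- Deleting inputs can only lose free names, so the freshness conditions of α-conversion and scope
extrusion survive. -/
theorem Proc.fn_binarize_subset (P : Proc) : P.binarize.fn ⊆ P.fn := by
  induction P with
  | nil => exact subset_rfl
  | ok => exact subset_rfl
  | par P Q hP hQ => exact Finset.union_subset_union hP hQ
  | res a P hP => exact Finset.erase_subset_erase _ hP
  | ite s t P Q hP hQ =>
    exact Finset.union_subset_union (Finset.union_subset_union subset_rfl hP) hQ
  | rep P hP => exact hP
  | aout o => exact subset_rfl
  | sout o P hP => exact Finset.union_subset_union subset_rfl hP
  | inp I P hP =>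
    unfold Proc.binarize
    split
    · exact Finset.union_subset_union subset_rfl (Finset.sdiff_subset_sdiff hP subset_rfl)
    · exact Finset.empty_subset _

theorem Alpha.allBinary_iff {P Q : Proc} (h : Alpha P Q) : P.AllBinary ↔ Q.AllBinary := by
  induction h <;> simp_all [Proc.AllBinary, Proc.allBinary_rename]

theorem Alpha.liveBinary_iff {P Q : Proc} (h : Alpha P Q) : P.LiveBinary ↔ Q.LiveBinary := by
  induction h with
  | convRes a b P _ => exact (Proc.liveBinary_rename (Equiv.swap a b).injective P).symm
  | inp I h => simp [Proc.LiveBinary, h.allBinary_iff]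
  | convInp => simp [Proc.LiveBinary, Proc.allBinary_rename]
  | _ => simp_all [Proc.LiveBinary]

theorem Alpha.binarize {P Q : Proc} (h : Alpha P Q) : Alpha P.binarize Q.binarize := by
  induction h with
  | refl P => exact .refl _
  | symm _ ih => exact ih.symm
  | trans _ _ ih₁ ih₂ => exact ih₁.trans ih₂
  | par _ _ ih₁ ih₂ => exact ih₁.par ih₂
  | res a _ ih => exact ih.res a
  | ite s t _ _ ih₁ ih₂ => exact ih₁.ite s t ih₂
  | rep _ ih => exact ih.rep
  | sout o _ ih => exact ih.sout o
  | inp I _ ih =>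
    unfold Proc.binarize
    split
    · exact ih.inp I
    · exact .refl _
  | convRes a b P hb =>
    simp only [Proc.binarize, Proc.binarize_rename]
    exact .convRes a b _ fun h => hb (P.fn_binarize_subset h)
  | convInp a b I P ha hb hP =>
    simp only [Proc.binarize, Proc.binarize_rename, List.length_map]
    split
    · exact .convInp a b I _ ha hb fun h => hP (P.fn_binarize_subset h)
    · exact .refl _

/-- `AllBinary` is not invariant: the axioms for conditionals, read from right to left, attach an
arbitrary discarded branch. -/
theorem SCAxiom.liveBinary_iff {P Q : Proc} (h : SCAxiom P Q) :
    P.LiveBinary ↔ Q.LiveBinary := by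
  cases h with
  | parComm => exact and_comm
  | parAssoc => exact and_assoc.symm
  | alpha h => exact h.liveBinary_iff
  | _ => simp_all [Proc.LiveBinary]

theorem SC.liveBinary_iff {L : Lang} {P Q : Proc} (h : SC L P Q) :
    P.LiveBinary ↔ Q.LiveBinary := by
  induction h with
  | ax _ _ h => exact h.liveBinary_iff
  | _ => simp_all [Proc.LiveBinary]

theorem SCAxiom.binarize {P Q : Proc} (h : SCAxiom P Q) : SCAxiom P.binarize Q.binarize := by
  cases h with
  | parNil P => exact .parNil _
  | parComm P Q => exact .parComm _ _
  | parAssoc P Q R => exact .parAssoc _ _ _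
  | iteEq s t P Q h => exact .iteEq s t _ _ h
  | iteNe s t P Q h => exact .iteNe s t _ _ h
  | alpha h => exact .alpha h.binarize
  | resNil a => exact .resNil a
  | resComm a b P => exact .resComm a b _
  | scope a P Q h => exact .scope a _ _ fun h' => h (P.fn_binarize_subset h')
  | rep P => exact .rep _

theorem Lang.WF.allBinary {L : Lang} (hL : L.coord = .B) {P : Proc} (h : L.WF P) :
    P.AllBinary := by
  induction P with
  | par P Q hP hQ => exact ⟨hP h.1, hQ h.2⟩
  | res a P hP => exact hP h
  | ite s t P Q hP hQ => exact ⟨hP h.1, hQ h.2⟩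
  | rep P hP => exact hP h
  | sout o P hP => exact hP h.2.2
  | inp I P hP =>
    have := h.1
    simp only [Lang.JoinOK, hL] at this
    exact ⟨this, hP h.2.2.2⟩
  | _ => trivial

/-! ### The inclusion of a binary language into the joining language with the same other features -/

section

variable {α : Synchronism} {β : Arity} {γ : Medium} {δ : Matching}

theorem Lang.WF.to_joining {P : Proc} (h : Lang.WF ⟨α, β, γ, δ, .B⟩ P) :
    Lang.WF ⟨α, β, γ, δ, .J⟩ P := by
  induction P with
  | nil => trivial
  | ok => trivial
  | par P Q hP hQ => exact ⟨hP h.1, hQ h.2⟩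
  | res a P hP => exact hP h
  | ite s t P Q hP hQ => exact ⟨hP h.1, hQ h.2⟩
  | rep P hP => exact hP h
  | aout o => exact h
  | sout o P hP => exact ⟨h.1, h.2.1, hP h.2.2⟩
  | inp I P hP => exact ⟨(show I.length = 1 from h.1).ge, h.2.1, h.2.2.1, hP h.2.2.2⟩

theorem Lang.WF.binarize {P : Proc} (h : Lang.WF ⟨α, β, γ, δ, .J⟩ P) :
    Lang.WF ⟨α, β, γ, δ, .B⟩ P.binarize := by
  induction P with
  | nil => trivial
  | ok => trivial
  | par P Q hP hQ => exact ⟨hP h.1, hQ h.2⟩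
  | res a P hP => exact hP h
  | ite s t P Q hP hQ => exact ⟨hP h.1, hQ h.2⟩
  | rep P hP => exact hP h
  | aout o => exact h
  | sout o P hP => exact ⟨h.1, h.2.1, hP h.2.2⟩
  | inp I P hP =>
    unfold Proc.binarize
    split
    · exact ⟨by assumption, h.2.1, h.2.2.1, hP h.2.2.2⟩
    · trivial

theorem SC.to_joining {P Q : Proc} (h : SC ⟨α, β, γ, δ, .B⟩ P Q) :
    SC ⟨α, β, γ, δ, .J⟩ P Q := by
  induction h with
  | refl h => exact .refl h.to_joining
  | symm _ ih => exact ih.symm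
  | trans _ _ ih₁ ih₂ => exact ih₁.trans ih₂
  | ax h₁ h₂ h => exact .ax h₁.to_joining h₂.to_joining h
  | par _ _ ih₁ ih₂ => exact ih₁.par ih₂
  | res a _ ih => exact ih.res a
  | ite s t _ _ ih₁ ih₂ => exact ih₁.ite s t ih₂
  | rep _ ih => exact ih.rep
  | sout o hs ho _ ih => exact .sout o hs ho ih

theorem SC.binarize {P Q : Proc} (h : SC ⟨α, β, γ, δ, .J⟩ P Q) :
    SC ⟨α, β, γ, δ, .B⟩ P.binarize Q.binarize := by
  induction h with
  | refl h => exact .refl h.binarize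
  | symm _ ih => exact ih.symm
  | trans _ _ ih₁ ih₂ => exact ih₁.trans ih₂
  | ax h₁ h₂ h => exact .ax h₁.binarize h₂.binarize h.binarize
  | par _ _ ih₁ ih₂ => exact ih₁.par ih₂
  | res a _ ih => exact ih.res a
  | ite s t _ _ ih₁ ih₂ => exact ih₁.ite s t ih₂
  | rep _ ih => exact ih.rep
  | sout o hs ho _ ih => exact .sout o hs ho ih

theorem Red.to_joining {P Q : Proc} (h : Red ⟨α, β, γ, δ, .B⟩ P Q) :
    Red ⟨α, β, γ, δ, .J⟩ P Q := by
  induction h with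
  | commA h hm => exact .commA h.to_joining hm
  | commS h hm => exact .commS h.to_joining hm
  | par hQ _ ih => exact .par hQ.to_joining ih
  | res a _ ih => exact ih.res a
  | struct h₁ _ h₂ ih => exact .struct h₁.to_joining ih h₂.to_joining

/-- A process with binary live inputs is structurally equivalent to a binary one. -/
theorem SC.self_binarize {P : Proc} (h : Lang.WF ⟨α, β, γ, δ, .J⟩ P) (hP : P.LiveBinary) :
    SC ⟨α, β, γ, δ, .J⟩ P P.binarize := by
  induction P with
  | nil => exact .refl h
  | ok => exact .refl h
  | par P Q ihP ihQ => exact (ihP h.1 hP.1).par (ihQ h.2 hP.2)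
  | res a P ihP => exact (ihP h hP).res a
  -- The discarded branch may not be equivalent to its binarized form, so both conditionals are
  -- resolved to the live branch instead.
  | ite s t P Q ihP ihQ =>
    by_cases hs : s = t
    · exact ((SC.iteEq hs h.1 h.2).trans (ihP h.1 (hP.1 hs))).trans
        (SC.iteEq hs h.1.binarize.to_joining h.2.binarize.to_joining).symm
    · exact ((SC.iteNe hs h.1 h.2).trans (ihQ h.2 (hP.2 hs))).trans
        (SC.iteNe hs h.1.binarize.to_joining h.2.binarize.to_joining).symm
  | rep P ihP => exact (ihP h hP).rep
  | aout o => exact .refl h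
  | sout o P ihP => exact .sout o h.1 h.2.1 (ihP h.2.2 hP)
  | inp I P =>
    -- Structural equivalence does not reach under an input, but there the process is entirely
    -- binary and `binarize` changes nothing.
    rw [Proc.AllBinary.binarize_eq (P := .inp I P) hP]
    exact .refl h

theorem liveBinary_parList {Ps : List Proc} {Q : Proc} :
    (parList Ps Q).LiveBinary ↔ (∀ P ∈ Ps, P.LiveBinary) ∧ Q.LiveBinary := by
  induction Ps with
  | nil => simp [parList]
  | cons P Ps ih =>
    change P.LiveBinary ∧ (parList Ps Q).LiveBinary ↔ _
    rw [ih]; simp [and_assoc]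

theorem binarize_parList (Ps : List Proc) (Q : Proc) :
    (parList Ps Q).binarize = parList (Ps.map Proc.binarize) Q.binarize := by
  induction Ps with
  | nil => rfl
  | cons P Ps ih => exact congrArg (Proc.par P.binarize) ih

/-- Reductions of processes with binary live inputs are reductions of the binary language. -/
theorem Red.binarize {P Q : Proc} (h : Red ⟨α, β, γ, δ, .J⟩ P Q) (hP : P.LiveBinary) :
    Q.LiveBinary ∧ Red ⟨α, β, γ, δ, .B⟩ P.binarize Q.binarize := by
  induction h with
  | @commA os I σ Q h hm =>
    -- For an input, `LiveBinary` and `AllBinary` are the same condition; the latter survives the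
    -- substitution into the continuation.
    have hI : (Proc.inp I Q).AllBinary := (liveBinary_parList.1 hP).2
    have hQ := hI.2.subst σ.fn
    refine ⟨hQ.liveBinary, ?_⟩
    have hwf := h.binarize
    rw [binarize_parList, hI.binarize_eq, List.map_map] at hwf ⊢
    rw [hQ.binarize_eq]
    exact .commA hwf hm
  | @commS os I σ Q h hm =>
    obtain ⟨ho, hI⟩ := liveBinary_parList.1 hP
    replace hI : (Proc.inp I Q).AllBinary := hI
    have hQ := hI.2.subst σ.fn
    refine ⟨liveBinary_parList.2 ⟨fun P hP => ?_, hQ.liveBinary⟩, ?_⟩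
    · obtain ⟨o, h, rfl⟩ := List.mem_map.1 hP
      exact ho (.sout o.1 o.2) (List.mem_map.2 ⟨o, h, rfl⟩)
    have hwf := h.binarize
    rw [binarize_parList, hI.binarize_eq, List.map_map] at hwf ⊢
    rw [binarize_parList, hQ.binarize_eq, List.map_map]
    have h₁ : os.map (Proc.binarize ∘ fun o => .sout o.1 o.2) =
        (os.map fun o => (o.1, o.2.binarize)).map fun o => .sout o.1 o.2 := by
      rw [List.map_map]; rfl
    have h₂ : os.map (Proc.binarize ∘ Prod.snd) =
        (os.map fun o => (o.1, o.2.binarize)).map Prod.snd := by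
      rw [List.map_map]; rfl
    rw [h₁] at hwf ⊢
    rw [h₂]
    exact .commS hwf (by rw [List.map_map]; exact hm)
  | par hQ _ ih =>
    obtain ⟨h₁, h₂⟩ := ih hP.1
    exact ⟨⟨h₁, hP.2⟩, h₂.par hQ.binarize⟩
  | res a _ ih =>
    obtain ⟨h₁, h₂⟩ := ih hP
    exact ⟨h₁, h₂.res a⟩
  | struct h₁ _ h₂ ih =>
    obtain ⟨h₃, h₄⟩ := ih (h₁.liveBinary_iff.1 hP)
    exact ⟨h₂.liveBinary_iff.1 h₃, .struct h₁.binarize h₄ h₂.binarize⟩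

/-- A process of the binary language as a process of the joining one. -/
def toJoining (P : Lang.Processes ⟨α, β, γ, δ, .B⟩) : Lang.Processes ⟨α, β, γ, δ, .J⟩ :=
  ⟨P.1, P.2.to_joining⟩

/-- A process of the joining language made binary. -/
def toBinary (P : Lang.Processes ⟨α, β, γ, δ, .J⟩) : Lang.Processes ⟨α, β, γ, δ, .B⟩ :=
  ⟨P.1.binarize, P.2.binarize⟩

theorem toBinary_toJoining (P : Lang.Processes ⟨α, β, γ, δ, .B⟩) :
    toBinary (toJoining P) = P :=
  Subtype.ext (P.2.allBinary rfl).binarize_eq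

theorem steps_toBinary {S T : Lang.Processes ⟨α, β, γ, δ, .J⟩} (hS : S.1.LiveBinary)
    (h : Lang.Steps S T) : T.1.LiveBinary ∧ Lang.Steps (toBinary S) (toBinary T) := by
  induction h with
  | refl => exact ⟨hS, .refl⟩
  | tail _ h ih =>
    obtain ⟨h₁, h₂⟩ := Red.binarize h ih.1
    exact ⟨h₁, ih.2.tail h₂⟩

theorem steps_toJoining {S T : Lang.Processes ⟨α, β, γ, δ, .B⟩} (h : Lang.Steps S T) :
    Lang.Steps (toJoining S) (toJoining T) := by
  induction h with
  | refl => exact .refl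
  | tail _ h ih => exact ih.tail (Red.to_joining h)

theorem liveBinary_toJoining (P : Lang.Processes ⟨α, β, γ, δ, .B⟩) :
    (toJoining P).1.LiveBinary := (P.2.allBinary rfl).liveBinary

/-- The inclusion of the binary language into the joining one. -/
def Encoding.inclusion (α : Synchronism) (β : Arity) (γ : Medium) (δ : Matching) :
    Encoding ⟨α, β, γ, δ, .B⟩ ⟨α, β, γ, δ, .J⟩ where
  tr := toJoining
  k := 1
  k_pos := one_pos
  ren a _ := a

/-- The context that consists of an operator applied to holes. -/
def Op.ctx : (op : Op) → Ctx op.arity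
  | .nil => .nil
  | .ok => .ok
  | .par => .par (.hole (0 : Fin 2)) (.hole (1 : Fin 2))
  | .res a => .res a (.hole (0 : Fin 1))
  | .ite s t => .ite s t (.hole (0 : Fin 2)) (.hole (1 : Fin 2))
  | .rep => .rep (.hole (0 : Fin 1))
  | .aout o => .aout o
  | .sout o => .sout o (.hole (0 : Fin 1))
  | .inp I => .inp I (.hole (0 : Fin 1))

theorem Op.fill_ctx (op : Op) (T : Fin op.arity → Proc) : op.ctx.fill T = op.app T := by
  cases op <;> rfl

theorem Op.count_holes_ctx (op : Op) (i : Fin op.arity) : op.ctx.holes.count i = 1 := by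
  have h₁ : ∀ i : Fin 1, [(0 : Fin 1)].count i = 1 := by decide
  have h₂ : ∀ i : Fin 2, [(0 : Fin 2), 1].count i = 1 := by decide
  cases op with
  | nil => exact i.elim0
  | ok => exact i.elim0
  | par => exact h₂ i
  | res a => exact h₁ i
  | ite s t => exact h₂ i
  | rep => exact h₁ i
  | aout o => exact i.elim0
  | sout o => exact h₁ i
  | inp I => exact h₁ i

theorem Encoding.inclusion_valid
    {R : Lang.Processes ⟨α, β, γ, δ, .J⟩ → Lang.Processes ⟨α, β, γ, δ, .J⟩ → Prop}
    (hR : IsReference ⟨α, β, γ, δ, .J⟩ R) (hsc : ∀ P Q, Lang.StructEquiv P Q → R P Q) :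
    (Encoding.inclusion α β γ δ).Valid R where
  compositional op hop N := by
    refine ⟨op.ctx, ⟨op.count_holes_ctx, ?_⟩, fun S _ => ?_⟩
    · rw [op.fill_ctx]
      exact Lang.WF.to_joining hop
    · rw [op.fill_ctx]
      exact .refl _
  name_invariant S f hf :=
    ⟨f, hf, fun _ _ => rfl, fun _ => .refl _, fun _ => hR.equivalence.refl _⟩
  operational := by
    refine ⟨fun S S' h => ⟨_, steps_toJoining h, hR.equivalence.refl _⟩, fun S T h => ?_⟩
    obtain ⟨hT, hs⟩ := steps_toBinary (liveBinary_toJoining S) h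
    rw [toBinary_toJoining] at hs
    -- No further steps are needed in the target: `T` is structurally equivalent to its binarized
    -- form, which is a derivative of `S`.
    exact ⟨toBinary T, T, hs, .refl, hsc _ _ (SC.self_binarize T.2 hT)⟩
  divergence S := by
    rintro ⟨f, h₀, hf⟩
    have hlive : ∀ n, (f n).1.LiveBinary := fun n => by
      induction n with
      | zero => rw [h₀]; exact liveBinary_toJoining S
      | succ n ih => exact (Red.binarize (hf n) ih).1
    refine ⟨fun n => toBinary (f n), ?_, fun n => (Red.binarize (hf n) (hlive n)).2⟩
    simp only [h₀]
    exact toBinary_toJoining S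
  success S := by
    constructor
    · rintro ⟨P', P'', hs, h⟩
      exact ⟨toJoining P', P'', steps_toJoining hs, h.to_joining⟩
    · rintro ⟨P', P'', hs, h⟩
      obtain ⟨-, hs⟩ := steps_toBinary (liveBinary_toJoining S) hs
      rw [toBinary_toJoining] at hs
      exact ⟨toBinary P', P''.binarize, hs, h.binarize⟩

end

end Calc

theorem mainTheorem2 :
    (∀ L₁ L₂ : Calc.Lang, L₁.coord = .J → L₂.coord = .B →
      ∀ R : L₂.Processes → L₂.Processes → Prop, Calc.IsReference L₂ R →
        ¬ ∃ e : Calc.Encoding L₁ L₂, e.Valid R) ∧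
    (∀ L : Calc.Lang, L.coord = .J → L.coordDegree = ⊤) ∧
    (∀ L : Calc.Lang, L.coord = .B → L.coordDegree = 2) ∧
    (∀ (α : Calc.Synchronism) (β : Calc.Arity) (γ : Calc.Medium) (δ : Calc.Matching)
      (R : Calc.Lang.Processes ⟨α, β, γ, δ, .J⟩ → Calc.Lang.Processes ⟨α, β, γ, δ, .J⟩ → Prop),
      Calc.IsReference ⟨α, β, γ, δ, .J⟩ R →
      (∀ P Q, Calc.Lang.StructEquiv P Q → R P Q) →
        ∃ e : Calc.Encoding ⟨α, β, γ, δ, .B⟩ ⟨α, β, γ, δ, .J⟩, e.Valid R) :=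
  ⟨fun _ _ h₁ h₂ _ hR ⟨e, he⟩ => e.not_valid h₁ h₂ hR he,
    fun _ h => Calc.Lang.coordDegree_joining h,
    fun _ h => Calc.Lang.coordDegree_binary h,
    fun α β γ δ _ hR hsc => ⟨Calc.Encoding.inclusion α β γ δ, Calc.Encoding.inclusion_valid hR hsc⟩⟩
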